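/- Let $\alpha\in(0,1)$. For $\mathbf{x}=(x,y)\in\mathbb{R}^2\setminus\{\mathbf 0\}$ put $\mathbf{A}_\alpha(\mathbf{x})=\alpha\,\frac{(-y,x)}{x^2+y^2}$ and $H_\alpha=(-i\nabla+\mathbf{A}_\alpha)^2$, and for $\varphi\in C^\infty_c(\mathbb{R}^2\setminus\{\mathbf 0\})$ put $Q_\alpha[\varphi]=\langle\varphi\,|\,H_\alpha\varphi\rangle=\|(-i\nabla+\mathbf{A}_\alpha)\varphi\|_2^2$. Let $\mathcal{D}[Q^{(F)}_\alpha]\subset L^2(\mathbb{R}^2)$ be the closure of $C^\infty_c(\mathbb{R}^2\setminus\{\mathbf 0\})$ with respect to the form norm $(\|\cdot\|_2^2+Q_\alpha[\cdot])^{1/2}$, that is, the set of all $L^2$-limits of sequences in $C^\infty_c(\mathbb{R}^2\setminus\{\mathbf 0\})$ that are Cauchy in this norm. For $\psi_1,\psi_2\in\mathcal{D}[Q^{(F)}_\alpha]$ let $Q^{(F)}_\alpha[\psi_1,\psi_2]=\langle(-i\nabla+\mathbf{A}_\alpha)\psi_1\,|\,(-i\nabla+\mathbf{A}_\alpha)\psi_2\rangle$,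 where $(-i\nabla+\mathbf{A}_\alpha)\psi_k$ is understood in the sense of distributions on $\mathbb{R}^2\setminus\{\mathbf 0\}$, and $Q^{(F)}_\alpha[\psi]=Q^{(F)}_\alpha[\psi,\psi]$. Then the following statements hold. 1. One has $$\mathcal{D}[Q^{(F)}_\alpha]=\{\psi\in H^1(\mathbb{R}^2)\;|\;\mathbf{A}_\alpha\psi\in L^2(\mathbb{R}^2)\},$$ for every $\psi$ in this domain the distribution $(-i\nabla+\mathbf{A}_\alpha)\psi$ on $\mathbb{R}^2\setminus\{\mathbf 0\}$ belongs to $L^2$, and the densely defined Hermitian form $Q^{(F)}_\alpha$ is closed and non-negative on this domain. 2. There is a self-adjoint operator $H^{(F)}_\alpha$ in $L^2(\mathbb{R}^2)$ associated with $Q^{(F)}_\alpha$: a function $\psi_2$ belongs to $\mathcal{D}(H^{(F)}_\alpha)$ with $H^{(F)}_\alpha\psi_2=\varphi$ if and only if $\psi_2\in\mathcal{D}[Q^{(F)}_\alpha]$, $\varphi\in L^2(\mathbb{R}^2)$ and $Q^{(F)}_\alpha[\psi_1,\psi_2]=\langle\psi_1\,|\,\varphi\rangle$ for all $\psi_1\in\mathcal{D}[Q^{(F)}_\alpha]$.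 It is the only self-adjoint operator $T$ with $\mathcal{D}(T)\subset\mathcal{D}[Q^{(F)}_\alpha]$ and $Q^{(F)}_\alpha[\psi_1,\psi_2]=\langle\psi_1\,|\,T\psi_2\rangle$ for all $\psi_1\in\mathcal{D}[Q^{(F)}_\alpha]$, $\psi_2\in\mathcal{D}(T)$. Its domain and action are $$\mathcal{D}(H^{(F)}_\alpha)=\{\psi\in\mathcal{D}[Q^{(F)}_\alpha]\;|\;H_\alpha\psi\in L^2(\mathbb{R}^2)\},\qquad H^{(F)}_\alpha\psi=H_\alpha\psi,$$ where $H_\alpha\psi$ is understood in the sense of distributions on $\mathbb{R}^2\setminus\{\mathbf 0\}$. -/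

import Mathlib

open MeasureTheory Filter Topology
open scoped ComplexConjugate Distributions InnerProductSpace

noncomputable section

namespace AharonovBohm

/-! ### Quadratic forms and operators on a Hilbert space -/

section Forms

variable {E : Type*} [NormedAddCommGroup E] [InnerProductSpace ℂ E]

/-- `q`, restricted to `D`, is a densely defined, nonnegative, closed Hermitian form on `E`
(antilinear in the first and linear in the second argument). Values of `q` off `D` play no role.
Closedness: a sequence in `D` that is Cauchy for the form norm `(‖u‖² + q[u])^{1/2}` converges
in this norm to an element of `D`. -/
structure IsClosedNonnegForm (D : Set E) (q : E → E → ℂ) : Prop where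
  dense : Dense D
  zero_mem : (0 : E) ∈ D
  add_mem : ∀ u ∈ D, ∀ v ∈ D, u + v ∈ D
  smul_mem : ∀ (c : ℂ), ∀ u ∈ D, c • u ∈ D
  add_right : ∀ u ∈ D, ∀ v ∈ D, ∀ w ∈ D, q u (v + w) = q u v + q u w
  smul_right : ∀ (c : ℂ), ∀ u ∈ D, ∀ v ∈ D, q u (c • v) = c * q u v
  conj_symm : ∀ u ∈ D, ∀ v ∈ D, conj (q u v) = q v u
  nonneg : ∀ u ∈ D, 0 ≤ (q u u).re
  complete : ∀ u : ℕ → E, (∀ n, u n ∈ D) → CauchySeq u →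
    Tendsto (fun p : ℕ × ℕ => (q (u p.1 - u p.2) (u p.1 - u p.2)).re) atTop (𝓝 0) →
    ∃ v ∈ D, Tendsto u atTop (𝓝 v) ∧
      Tendsto (fun n => (q (u n - v) (u n - v)).re) atTop (𝓝 0)

/-- `T` is the operator defined by the form `q` on `D`: the domain of `T` consists of the `v ∈ D`
for which some `w` satisfies `q u v = ⟪u, w⟫` for all `u ∈ D`, and then `T v = w`. -/
def IsAssociatedOperator (D : Set E) (q : E → E → ℂ) (T : E →ₗ.[ℂ] E) : Prop :=
  ∀ v w : E, (v, w) ∈ T.graph ↔ v ∈ D ∧ ∀ u ∈ D, q u v = ⟪u, w⟫_ℂ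

/-- `T` represents the form `q` on `D`: its domain is contained in `D` and `q u v = ⟪u, T v⟫` for
all `u ∈ D` and all `v` in the domain of `T`. -/
def Represents (D : Set E) (q : E → E → ℂ) (T : E →ₗ.[ℂ] E) : Prop :=
  (T.domain : Set E) ⊆ D ∧ ∀ v : T.domain, ∀ u ∈ D, q u v = ⟪u, T v⟫_ℂ

end Forms

/-! ### The Aharonov-Bohm potential and the differential expressions -/

/-- The Euclidean plane. -/
abbrev Plane : Type := EuclideanSpace ℝ (Fin 2)

/-- The complex Hilbert space `L²(ℝ²)`. -/
abbrev L2 : Type := Lp ℂ 2 (volume : Measure Plane)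

/-- The plane without the origin, so that `𝓓(punctured, ℂ)` is `C_c^∞(ℝ² ∖ {0})`. -/
def punctured : TopologicalSpace.Opens Plane := ⟨{0}ᶜ, isOpen_compl_singleton⟩

/-- The potential `A_α(x) = α x^⊥ / |x|²`, where `x^⊥ = (-x₂, x₁)`. -/
def potential (α : ℝ) (x : Plane) : Plane := (α / ‖x‖ ^ 2) • !₂[-x 1, x 0]

/-- The classical partial derivative `∂_j f`. -/
def partialDeriv (j : Fin 2) (f : Plane → ℂ) (x : Plane) : ℂ :=
  fderiv ℝ f x (EuclideanSpace.single j 1)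

/-- The `j`-th component of `(-i∇ + A_α) f`, in the classical sense. -/
def magDeriv (α : ℝ) (j : Fin 2) (f : Plane → ℂ) (x : Plane) : ℂ :=
  -Complex.I * partialDeriv j f x + (potential α x j : ℂ) * f x

/-- `H_α f = (-i∇ + A_α)² f`, in the classical sense. -/
def hamiltonian (α : ℝ) (f : Plane → ℂ) (x : Plane) : ℂ :=
  ∑ j, magDeriv α j (magDeriv α j f) x

/-- `Q_α[φ] = ‖(-i∇ + A_α) φ‖₂²` for `φ ∈ C_c^∞(ℝ² ∖ {0})`. -/
def testForm (α : ℝ) (φ : 𝓓(punctured, ℂ)) : ℝ :=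
  ∑ j, ∫ x, ‖magDeriv α j φ x‖ ^ 2

/-! ### Distributional derivatives -/

/-- `ψ ∈ H¹(ℝ²)`: the function `ψ ∈ L²` has weak partial derivatives in `L²` on the whole plane. -/
def MemH1 (ψ : L2) : Prop :=
  ∃ g : Fin 2 → L2, ∀ (j : Fin 2) (φ : 𝓓((⊤ : TopologicalSpace.Opens Plane), ℂ)),
    ∫ x, partialDeriv j φ x * ψ x = -∫ x, φ x * g j x

/-- `(-i∇ + A_α) ψ = g` in the sense of distributions on `ℝ² ∖ {0}`. The expressions
`-i∂_j + (A_α)_j` are formally self-adjoint. -/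
def IsMagGradient (α : ℝ) (ψ : L2) (g : Fin 2 → L2) : Prop :=
  ∀ (j : Fin 2) (φ : 𝓓(punctured, ℂ)),
    ∫ x, conj (magDeriv α j φ x) * ψ x = ∫ x, conj (φ x) * g j x

/-- `H_α ψ = η` in the sense of distributions on `ℝ² ∖ {0}`. The expression `H_α` is formally
self-adjoint. -/
def IsHamiltonian (α : ℝ) (ψ η : L2) : Prop :=
  ∀ φ : 𝓓(punctured, ℂ),
    ∫ x, conj (hamiltonian α φ x) * ψ x = ∫ x, conj (φ x) * η x

/-! ### The Friedrichs form -/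

/-- The domain of the Friedrichs form, as a subset of `L²(ℝ²)`: the closure of
`C_c^∞(ℝ² ∖ {0})` under the form norm. Its elements are the `L²` limits of sequences of test
functions that are Cauchy with respect to `Q_α`. -/
def friedrichsDomain (α : ℝ) : Set L2 :=
  {ψ | ∃ φ : ℕ → 𝓓(punctured, ℂ),
    Tendsto (fun n => eLpNorm (fun x => φ n x - ψ x) 2 volume) atTop (𝓝 0) ∧
    Tendsto (fun p : ℕ × ℕ => testForm α (φ p.1 - φ p.2)) atTop (𝓝 0)}

open scoped Classical in
/-- The element `(-i∇ + A_α) ψ` of `L²`, if this distribution on `ℝ² ∖ {0}` is in `L²`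
(it is then unique), and `0` otherwise. -/
def magGradient (α : ℝ) (ψ : L2) : Fin 2 → L2 :=
  if h : ∃ g, IsMagGradient α ψ g then h.choose else 0

/-- The Friedrichs form `Q[ψ₁, ψ₂] = ⟨(-i∇ + A_α) ψ₁ | (-i∇ + A_α) ψ₂⟩`. -/
def friedrichsForm (α : ℝ) (ψ₁ ψ₂ : L2) : ℂ :=
  ∑ j, ⟪magGradient α ψ₁ j, magGradient α ψ₂ j⟫_ℂ

end AharonovBohm

end

open AharonovBohm

/-! Let `G` be the closure in `L² × (L²)²` of the graph of `-i∇ + A_α` on test functions. Formal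
symmetry (`inner_magTest`) survives the limit, so a point `(ψ, k)` of `G` has `k` as its
distributional magnetic gradient, which is unique. Hence `G` is again a graph, namely that of a
closed, densely defined operator `S` with the Friedrichs domain, and the form is `⟪S u, S v⟫`.
Closedness of the form is closedness of `G`.

The operator of the form is `S*S`. To solve `v + S*S v = f`, project `(f, 0)` orthogonally onto `G`.
Symmetry and surjectivity of `S*S + 1` give self-adjointness, and self-adjoint operators have no
proper self-adjoint restrictions, whence uniqueness. Test functions are a form core, so the weak
equation against all of the form domain is the same as `H_α ψ = η` in distributions
(`isHamiltonian_iff_friedrichsForm`).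

The form domain lies in `H¹` with `A_α ψ ∈ L²` by the Hardy inequality `lintegral_hardy`. Along a
circle, `e^{iαt} φ(R_t x)` has derivative of size `|x|` times the magnetic gradient at most, while a
full turn multiplies `φ(x)` by `e^{2πiα} ≠ 1`. Thus `φ(x)` is controlled by the circle integral, and
`‖φ / |x|‖₂²` by a constant times `Q_α[φ]`.

Conversely, `A_α ψ ∈ L²` means `ψ / |x| ∈ L²`. Cutoffs near `0` and infinity with gradient `O(1 /
|x|)` then cost nothing in the limit (`mem_friedrichsDomain_of_memH1`), and what remains is
supported away from `0`, where mollification gives test functions (`mem_magGraph_of_isCompact`). -/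

noncomputable section

namespace AharonovBohm


/-! ### Closed operators `S`, the form `⟪S u, S v⟫` and the operator `S*S` -/

section AbstractForms

variable {H K : Type*} [NormedAddCommGroup H] [InnerProductSpace ℂ H]
  [NormedAddCommGroup K] [InnerProductSpace ℂ K]
  {G : Submodule ℂ (WithLp 2 (H × K))} {D : Set H} {S : H → K}

/-- `G` is the graph of the map `S` with domain `D`. -/
def IsGraphOf (G : Submodule ℂ (WithLp 2 (H × K))) (D : Set H) (S : H → K) : Prop :=
  ∀ u k, WithLp.toLp 2 (u, k) ∈ G ↔ u ∈ D ∧ S u = k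

namespace IsGraphOf

theorem mem (hG : IsGraphOf G D S) {u : H} (hu : u ∈ D) : WithLp.toLp 2 (u, S u) ∈ G :=
  (hG _ _).2 ⟨hu, rfl⟩

theorem zero_mem (hG : IsGraphOf G D S) : (0 : H) ∈ D :=
  ((hG 0 0).1 G.zero_mem).1

theorem add_mem (hG : IsGraphOf G D S) {u v : H} (hu : u ∈ D) (hv : v ∈ D) :
    u + v ∈ D ∧ S (u + v) = S u + S v :=
  (hG _ _).1 (G.add_mem (hG.mem hu) (hG.mem hv))

theorem smul_mem (hG : IsGraphOf G D S) (c : ℂ) {u : H} (hu : u ∈ D) :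
    c • u ∈ D ∧ S (c • u) = c • S u :=
  (hG _ _).1 (G.smul_mem c (hG.mem hu))

theorem sub_mem (hG : IsGraphOf G D S) {u v : H} (hu : u ∈ D) (hv : v ∈ D) :
    u - v ∈ D ∧ S (u - v) = S u - S v :=
  (hG _ _).1 (G.sub_mem (hG.mem hu) (hG.mem hv))

/-- Along a form-Cauchy sequence both `u n` and `S (u n)` converge by completeness, and closedness
of `G` puts the limit pair on the graph. -/
theorem isClosedNonnegForm [CompleteSpace H] [CompleteSpace K] (hG : IsGraphOf G D S)
    (hcl : IsClosed (G : Set (WithLp 2 (H × K)))) (hD : Dense D) {q : H → H → ℂ}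
    (hq : ∀ u v, q u v = ⟪S u, S v⟫_ℂ) : IsClosedNonnegForm D q where
  dense := hD
  zero_mem := hG.zero_mem
  add_mem u hu v hv := (hG.add_mem hu hv).1
  smul_mem c u hu := (hG.smul_mem c hu).1
  add_right u _ v hv w hw := by simp only [hq, (hG.add_mem hv hw).2, inner_add_right]
  smul_right c u _ v hv := by simp only [hq, (hG.smul_mem c hv).2, inner_smul_right]
  conj_symm u _ v _ := by simp only [hq, inner_conj_symm]
  nonneg u _ := by
    rw [hq]
    exact inner_self_nonneg (𝕜 := ℂ)
  complete u hu hc ht := by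
    have key : ∀ v ∈ D, ∀ n, (q (u n - v) (u n - v)).re = ‖S (u n) - S v‖ ^ 2 := by
      intro v hv n
      rw [hq, (hG.sub_mem (hu n) hv).2]
      exact inner_self_eq_norm_sq (𝕜 := ℂ) _
    have hS : CauchySeq fun n => S (u n) := by
      rw [cauchySeq_iff_tendsto_dist_atTop_0]
      have : (fun p : ℕ × ℕ => dist (S (u p.1)) (S (u p.2))) =
          fun p => √(q (u p.1 - u p.2) (u p.1 - u p.2)).re := by
        funext p
        rw [key _ (hu _), Real.sqrt_sq (norm_nonneg _), dist_eq_norm]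
      rw [this]
      simpa using ht.sqrt
    obtain ⟨v, hv⟩ := cauchySeq_tendsto_of_complete hc
    obtain ⟨k, hk⟩ := cauchySeq_tendsto_of_complete hS
    have hlim : Tendsto (fun n => WithLp.toLp 2 (u n, S (u n))) atTop (𝓝 (WithLp.toLp 2 (v, k))) :=
      ((WithLp.prod_continuous_toLp 2 H K).tendsto (v, k)).comp (hv.prodMk_nhds hk)
    have hmem := (hG v k).1 (hcl.mem_of_tendsto hlim (Eventually.of_forall fun n => hG.mem (hu n)))
    refine ⟨v, hmem.1, hv, ?_⟩
    simp only [key v hmem.1, hmem.2]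
    simpa using ((tendsto_iff_norm_sub_tendsto_zero.1 hk).pow 2)

/-- The graph of the operator associated with the form `⟪S u, S v⟫`. -/
def operatorGraph (hG : IsGraphOf G D S) : Submodule ℂ (H × H) where
  carrier := {p | p.1 ∈ D ∧ ∀ u ∈ D, ⟪S u, S p.1⟫_ℂ = ⟪u, p.2⟫_ℂ}
  zero_mem' := ⟨hG.zero_mem, fun u _ => by
    have h := (hG.smul_mem 0 hG.zero_mem).2
    simp only [zero_smul] at h
    simp [h]⟩
  add_mem' {a b} ha hb := ⟨(hG.add_mem ha.1 hb.1).1, fun u hu => by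
    simp only [Prod.fst_add, Prod.snd_add, (hG.add_mem ha.1 hb.1).2, inner_add_right, ha.2 u hu,
      hb.2 u hu]⟩
  smul_mem' c {a} ha := ⟨(hG.smul_mem c ha.1).1, fun u hu => by
    simp only [Prod.smul_fst, Prod.smul_snd, (hG.smul_mem c ha.1).2, inner_smul_right, ha.2 u hu]⟩

theorem mem_operatorGraph (hG : IsGraphOf G D S) {v w : H} :
    (v, w) ∈ hG.operatorGraph ↔ v ∈ D ∧ ∀ u ∈ D, ⟪S u, S v⟫_ℂ = ⟪u, w⟫_ℂ := Iff.rfl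

/-- The operator associated with the form `⟪S u, S v⟫`. -/
def operator (hG : IsGraphOf G D S) : H →ₗ.[ℂ] H := hG.operatorGraph.toLinearPMap

theorem mem_operator_graph (hG : IsGraphOf G D S) (hD : Dense D) {v w : H} :
    (v, w) ∈ hG.operator.graph ↔ v ∈ D ∧ ∀ u ∈ D, ⟪S u, S v⟫_ℂ = ⟪u, w⟫_ℂ := by
  rw [operator, Submodule.toLinearPMap_graph_eq]
  · exact hG.mem_operatorGraph
  -- Single-valuedness: over `v = 0` the defining identity makes `w` orthogonal to the dense set
  -- `D`.
  · rintro ⟨v, w⟩ h (rfl : v = 0)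
    have h0 := (hG.smul_mem 0 hG.zero_mem).2
    simp only [zero_smul] at h0
    refine hD.eq_zero_of_inner_left (𝕜 := ℂ) fun u hu => ?_
    have := (hG.mem_operatorGraph.1 h).2 u hu
    rw [h0, inner_zero_right] at this
    rw [← inner_conj_symm, ← this, map_zero]

/-- The solution is the first component of the orthogonal projection of `(f, 0)` onto `G`. The
remainder `(f - v, -S v)` is orthogonal to every `(u, S u)`, which is the claimed weak equation. -/
theorem exists_form_add_inner_eq [CompleteSpace H] [CompleteSpace K] (hG : IsGraphOf G D S)
    (hcl : IsClosed (G : Set (WithLp 2 (H × K)))) (f : H) :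
    ∃ v, v ∈ D ∧ ∀ u ∈ D, ⟪S u, S v⟫_ℂ = ⟪u, f - v⟫_ℂ := by
  have : CompleteSpace G := hcl.completeSpace_coe
  let p : WithLp 2 (H × K) := G.starProjection (WithLp.toLp 2 (f, 0))
  have hp : p ∈ G := Submodule.starProjection_apply_mem _ _
  have hpp := (hG p.fst p.snd).1 hp
  refine ⟨p.fst, hpp.1, fun u hu => ?_⟩
  have h := Submodule.starProjection_inner_eq_zero (K := G) (WithLp.toLp 2 (f, 0)) _ (hG.mem hu)
  have h' : ⟪(WithLp.toLp 2 (u, S u) : WithLp 2 (H × K)), WithLp.toLp 2 (f, 0) - p⟫_ℂ = 0 := by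
    rw [← inner_conj_symm, h, map_zero]
  rw [WithLp.prod_inner_apply] at h'
  simp only [WithLp.ofLp_sub, Prod.fst_sub, Prod.snd_sub] at h'
  have e : S p.fst = (WithLp.ofLp p).2 := hpp.2
  rw [e]
  simp only [zero_sub, inner_neg_right] at h'
  exact (sub_eq_zero.1 (by rw [← h']; ring!)).symm

end IsGraphOf

/-- A symmetric operator `T` with dense domain such that `T + 1` is onto is self-adjoint. -/
theorem isSelfAdjoint_of_symmetric_of_surjective [CompleteSpace H] {T : H →ₗ.[ℂ] H}
    (hd : Dense (T.domain : Set H)) (hs : T.IsFormalAdjoint T)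
    (hsurj : ∀ f : H, ∃ v : T.domain, T v + v = f) : IsSelfAdjoint T := by
  rw [LinearPMap.isSelfAdjoint_def]
  refine (LinearPMap.IsFormalAdjoint.le_adjoint hd hs).antisymm' ?_
  have hle := LinearPMap.IsFormalAdjoint.le_adjoint hd hs
  -- Pick `v` with `(T + 1) v = (T* + 1) y`. Then `v - y` is orthogonal to the range of `T + 1`,
  -- hence to itself.
  have key : ∀ y : T.adjoint.domain, ∃ v : T.domain, (v : H) = y := by
    intro y
    obtain ⟨v, hv⟩ := hsurj (T.adjoint y + y)
    refine ⟨v, ?_⟩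
    rw [← sub_eq_zero]
    obtain ⟨w, hw⟩ := hsurj ((v : H) - y)
    have h1 := LinearPMap.adjoint_isFormalAdjoint hd y w
    have h2 := hs v w
    rw [← inner_self_eq_zero (𝕜 := ℂ)]
    nth_rewrite 2 [← hw]
    rw [inner_add_right, inner_sub_left, inner_sub_left, ← h1, ← h2]
    have h3 : ⟪T v, (w : H)⟫_ℂ + ⟪(v : H), (w : H)⟫_ℂ = ⟪T.adjoint y, (w : H)⟫_ℂ + ⟪(y : H), (w : H)⟫_ℂ := by
      rw [← inner_add_left, ← inner_add_left, hv]
    linear_combination h3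
  refine ⟨fun y hy => ?_, fun y v hyv => ?_⟩
  · obtain ⟨v, hv⟩ := key ⟨y, hy⟩
    have : (v : H) = y := hv
    exact this ▸ v.2
  · exact (hle.2 hyv.symm).symm

/-- Self-adjoint operators are maximal among self-adjoint operators. -/
theorem eq_of_le_of_isSelfAdjoint [CompleteSpace H] {T T' : H →ₗ.[ℂ] H} (hT : IsSelfAdjoint T)
    (hT' : IsSelfAdjoint T') (h : T' ≤ T) : T' = T := by
  refine h.antisymm ?_
  -- From `T' ≤ T = T*` the two operators are formally adjoint, so `T ≤ T'* = T'`.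
  have hf : T'.IsFormalAdjoint T := fun x y => by
    have hx := h.2 (x := x) (y := ⟨x, h.1 x.2⟩) rfl
    have := LinearPMap.adjoint_isFormalAdjoint hT.dense_domain
    rw [LinearPMap.isSelfAdjoint_def.1 hT] at this
    rw [hx]
    exact this ⟨x, h.1 x.2⟩ y
  have := LinearPMap.IsFormalAdjoint.le_adjoint hT'.dense_domain hf
  rwa [LinearPMap.isSelfAdjoint_def.1 hT'] at this

namespace IsGraphOf

theorem isAssociatedOperator (hG : IsGraphOf G D S) (hD : Dense D) {q : H → H → ℂ}
    (hq : ∀ u v, q u v = ⟪S u, S v⟫_ℂ) : IsAssociatedOperator D q hG.operator := by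
  intro v w
  simp only [hq, hG.mem_operator_graph hD]

variable [CompleteSpace H] [CompleteSpace K]

theorem isSelfAdjoint_operator (hG : IsGraphOf G D S)
    (hcl : IsClosed (G : Set (WithLp 2 (H × K)))) (hD : Dense D) : IsSelfAdjoint hG.operator := by
  have hmem : ∀ v : hG.operator.domain, (v : H) ∈ D ∧
      ∀ u ∈ D, ⟪S u, S v⟫_ℂ = ⟪u, hG.operator v⟫_ℂ := fun v =>
    (hG.mem_operator_graph hD).1 (hG.operator.mem_graph v)
  have hsurj : ∀ f : H, ∃ v : hG.operator.domain, hG.operator v + v = f := by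
    intro f
    obtain ⟨v, hv⟩ := hG.exists_form_add_inner_eq hcl f
    have := (hG.mem_operator_graph hD).2 hv
    obtain ⟨v', h1, h2⟩ := (LinearPMap.mem_graph_iff _).1 this
    refine ⟨v', ?_⟩
    simp only at h1 h2
    rw [h2, h1, sub_add_cancel]
  refine isSelfAdjoint_of_symmetric_of_surjective ?_ ?_ hsurj
  · rw [Submodule.dense_iff_topologicalClosure_eq_top, Submodule.topologicalClosure_eq_top_iff,
      Submodule.eq_bot_iff]
    intro f hf
    -- For `f` orthogonal to the domain, write `f = v + S*S v` and pair with `v`: this gives `‖S v‖²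
    -- + ‖v‖² = 0`.
    obtain ⟨v, hv⟩ := hsurj f
    have h0 : ⟪(v : H), f⟫_ℂ = 0 := (Submodule.mem_orthogonal _ _).1 hf v v.2
    rw [← hv, inner_add_right, ← (hmem v).2 v (hmem v).1] at h0
    have h1 := congrArg Complex.re h0
    have e1 : (⟪S v, S v⟫_ℂ).re = ‖S v‖ ^ 2 := inner_self_eq_norm_sq (𝕜 := ℂ) _
    have e2 : (⟪(v : H), (v : H)⟫_ℂ).re = ‖(v : H)‖ ^ 2 := inner_self_eq_norm_sq (𝕜 := ℂ) _
    rw [Complex.add_re, e1, e2, Complex.zero_re] at h1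
    have h2 : ‖(v : H)‖ = 0 := by
      have := sq_nonneg ‖S v‖
      have := sq_nonneg ‖(v : H)‖
      exact pow_eq_zero_iff two_ne_zero |>.1 (by linarith)
    have h3 : v = 0 := by simpa using h2
    rw [← hv, h3]
    simp
  · intro x y
    rw [← (hmem y).2 x (hmem x).1, ← inner_conj_symm, ← (hmem x).2 y (hmem y).1, inner_conj_symm]

/-- Representing the form makes `T` a restriction of the associated operator; maximality of
self-adjoint operators turns this into equality. -/
theorem eq_operator_of_represents (hG : IsGraphOf G D S)
    (hcl : IsClosed (G : Set (WithLp 2 (H × K)))) (hD : Dense D) {q : H → H → ℂ}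
    (hq : ∀ u v, q u v = ⟪S u, S v⟫_ℂ) {T : H →ₗ.[ℂ] H} (hT : IsSelfAdjoint T)
    (hr : Represents D q T) : T = hG.operator := by
  refine eq_of_le_of_isSelfAdjoint (hG.isSelfAdjoint_operator hcl hD) hT ?_
  refine LinearPMap.le_of_le_graph ?_
  rintro ⟨v, w⟩ hvw
  obtain ⟨v', rfl, rfl⟩ := (LinearPMap.mem_graph_iff _).1 hvw
  exact (hG.mem_operator_graph hD).2 ⟨hr.1 v'.2, fun u hu => by rw [← hq, hr.2 v' u hu]⟩

end IsGraphOf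

end AbstractForms


/-! ### The potential and test functions on the punctured plane -/

theorem potential_zero (α : ℝ) (x : Plane) : potential α x 0 = -(α * x 1 / ‖x‖ ^ 2) := by
  simp [potential]; ring

theorem potential_one (α : ℝ) (x : Plane) : potential α x 1 = α * x 0 / ‖x‖ ^ 2 := by
  simp [potential]; ring

theorem contDiffAt_potential (α : ℝ) (j : Fin 2) {x : Plane} (hx : x ≠ 0) {n : ℕ∞} :
    ContDiffAt ℝ n (fun y => potential α y j) x := by
  have hn : ContDiffAt ℝ n (fun y : Plane => ‖y‖ ^ 2) x := (contDiff_norm_sq ℝ).contDiffAt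
  have hne : ‖x‖ ^ 2 ≠ 0 := pow_ne_zero 2 (norm_ne_zero_iff.2 hx)
  have hc : ∀ i : Fin 2, ContDiffAt ℝ n (fun y : Plane => y i) x := fun i =>
    (EuclideanSpace.proj (𝕜 := ℝ) i : Plane →L[ℝ] ℝ).contDiff.contDiffAt
  fin_cases j
  · simp only [Fin.zero_eta, potential_zero]
    exact ((contDiffAt_const.mul (hc 1)).div hn hne).neg
  · simp only [Fin.mk_one, potential_one]
    exact (contDiffAt_const.mul (hc 0)).div hn hne

theorem mem_punctured {x : Plane} : x ∈ (punctured : Set Plane) ↔ x ≠ 0 := Iff.rfl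

theorem contDiff_partialDeriv {f : Plane → ℂ} (hf : ContDiff ℝ (⊤ : ℕ∞) f) (j : Fin 2) :
    ContDiff ℝ (⊤ : ℕ∞) (partialDeriv j f) :=
  (hf.fderiv_right (m := (⊤ : ℕ∞)) (by simp)).clm_apply contDiff_const

theorem partialDeriv_eventuallyEq_zero {f : Plane → ℂ} {x : Plane} (hf : f =ᶠ[𝓝 x] 0) (j : Fin 2) :
    partialDeriv j f =ᶠ[𝓝 x] 0 := by
  filter_upwards [hf.fderiv (𝕜 := ℝ)] with y hy
  simp [partialDeriv, hy]

theorem magDeriv_eventuallyEq_zero (α : ℝ) {f : Plane → ℂ} {x : Plane} (hf : f =ᶠ[𝓝 x] 0)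
    (j : Fin 2) : magDeriv α j f =ᶠ[𝓝 x] 0 := by
  filter_upwards [hf, partialDeriv_eventuallyEq_zero hf j] with y h1 h2
  simp [magDeriv, h1, h2]

theorem tsupport_magDeriv_subset (α : ℝ) (j : Fin 2) (f : Plane → ℂ) :
    tsupport (magDeriv α j f) ⊆ tsupport f := by
  intro x hx
  contrapose! hx
  rw [notMem_tsupport_iff_eventuallyEq] at hx ⊢
  exact magDeriv_eventuallyEq_zero α hx j

theorem tsupport_partialDeriv_subset (j : Fin 2) (f : Plane → ℂ) :
    tsupport (partialDeriv j f) ⊆ tsupport f := by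
  intro x hx
  contrapose! hx
  rw [notMem_tsupport_iff_eventuallyEq] at hx ⊢
  exact partialDeriv_eventuallyEq_zero hx j

/-- Near the origin the function vanishes identically, so a singular coefficient there does no harm.
-/
theorem contDiff_of_tsupport_subset_punctured {f : Plane → ℂ}
    (hf : tsupport f ⊆ (punctured : Set Plane))
    (h : ∀ x ≠ 0, ContDiffAt ℝ (⊤ : ℕ∞) f x) : ContDiff ℝ (⊤ : ℕ∞) f := by
  rw [contDiff_iff_contDiffAt]
  intro x
  by_cases hx : x ∈ tsupport f
  · exact h x (mem_punctured.1 (hf hx))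
  · rw [notMem_tsupport_iff_eventuallyEq] at hx
    exact contDiffAt_const.congr_of_eventuallyEq hx

theorem contDiffAt_magDeriv (α : ℝ) (j : Fin 2) {f : Plane → ℂ} (hf : ContDiff ℝ (⊤ : ℕ∞) f)
    {x : Plane} (hx : x ≠ 0) : ContDiffAt ℝ (⊤ : ℕ∞) (magDeriv α j f) x :=
  (contDiffAt_const.mul (contDiff_partialDeriv hf j).contDiffAt).add
    ((Complex.ofRealCLM.contDiff.contDiffAt.comp x (contDiffAt_potential α j hx)).mul
      hf.contDiffAt)

theorem partialDeriv_add {f g : Plane → ℂ} {x : Plane} (hf : DifferentiableAt ℝ f x)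
    (hg : DifferentiableAt ℝ g x) (j : Fin 2) :
    partialDeriv j (f + g) x = partialDeriv j f x + partialDeriv j g x := by
  simp [partialDeriv, fderiv_add hf hg]

theorem partialDeriv_const_smul {f : Plane → ℂ} {x : Plane} (hf : DifferentiableAt ℝ f x) (c : ℂ)
    (j : Fin 2) : partialDeriv j (c • f) x = c * partialDeriv j f x := by
  simp [partialDeriv, fderiv_const_smul hf c]

theorem partialDeriv_mul {f g : Plane → ℂ} {x : Plane} (hf : DifferentiableAt ℝ f x)
    (hg : DifferentiableAt ℝ g x) (j : Fin 2) :
    partialDeriv j (fun y => f y * g y) x = f x * partialDeriv j g x + g x * partialDeriv j f x := by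
  simp [partialDeriv, fderiv_fun_mul hf hg]

theorem partialDeriv_conj {f : Plane → ℂ} {x : Plane} (hf : DifferentiableAt ℝ f x) (j : Fin 2) :
    partialDeriv j (fun y => conj (f y)) x = conj (partialDeriv j f x) := by
  have := (Complex.conjCLE.toContinuousLinearMap.hasFDerivAt.comp x hf.hasFDerivAt).fderiv
  have h2 : (fun y => conj (f y)) = (Complex.conjCLE.toContinuousLinearMap ∘ f) := rfl
  rw [partialDeriv, h2, this]
  rfl

theorem _root_.TestFunction.differentiableAt {Ω : TopologicalSpace.Opens Plane} (φ : 𝓓(Ω, ℂ))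
    (x : Plane) : DifferentiableAt ℝ φ x :=
  (φ.contDiff.differentiable (by simp)) x

/-- The differential expression `(-i∇ + A_α)_j` acting on `C_c^∞(ℝ² ∖ {0})`. -/
def magTest (α : ℝ) (j : Fin 2) : 𝓓(punctured, ℂ) →ₗ[ℂ] 𝓓(punctured, ℂ) where
  toFun φ :=
    { toFun := magDeriv α j φ
      contDiff' := contDiff_of_tsupport_subset_punctured
        ((tsupport_magDeriv_subset α j φ).trans φ.tsupport_subset)
        fun _ hx => contDiffAt_magDeriv α j φ.contDiff hx
      hasCompactSupport' := φ.hasCompactSupport.of_isClosed_subset (isClosed_tsupport _)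
        (tsupport_magDeriv_subset α j φ)
      tsupport_subset' := (tsupport_magDeriv_subset α j φ).trans φ.tsupport_subset }
  map_add' φ χ := by
    ext x
    change magDeriv α j (φ + χ) x = magDeriv α j φ x + magDeriv α j χ x
    simp only [magDeriv, partialDeriv_add (φ.differentiableAt x) (χ.differentiableAt x), Pi.add_apply]
    ring
  map_smul' c φ := by
    ext x
    change magDeriv α j (c • φ) x = c • magDeriv α j φ x
    simp only [magDeriv, partialDeriv_const_smul (φ.differentiableAt x), Pi.smul_apply, smul_eq_mul]
    ring

@[simp]
theorem coe_magTest (α : ℝ) (j : Fin 2) (φ : 𝓓(punctured, ℂ)) :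
    ⇑(magTest α j φ) = magDeriv α j φ := rfl

theorem memLp_testFunction {Ω : TopologicalSpace.Opens Plane} (φ : 𝓓(Ω, ℂ)) :
    MemLp φ 2 (volume : Measure Plane) :=
  φ.continuous.memLp_of_hasCompactSupport φ.hasCompactSupport

/-- The inclusion of `C_c^∞(ℝ² ∖ {0})` into `L²(ℝ²)`. -/
def testL2 : 𝓓(punctured, ℂ) →ₗ[ℂ] L2 where
  toFun φ := (memLp_testFunction φ).toLp φ
  map_add' φ χ := MemLp.toLp_add (memLp_testFunction φ) (memLp_testFunction χ)
  map_smul' c φ := MemLp.toLp_const_smul c (memLp_testFunction φ)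

theorem coeFn_testL2 (φ : 𝓓(punctured, ℂ)) : testL2 φ =ᵐ[volume] φ :=
  MemLp.coeFn_toLp (memLp_testFunction φ)

theorem inner_testL2 (φ : 𝓓(punctured, ℂ)) (f : L2) :
    ⟪testL2 φ, f⟫_ℂ = ∫ x, conj (φ x) * f x := by
  rw [L2.inner_def]
  refine integral_congr_ae ?_
  filter_upwards [coeFn_testL2 φ] with x hx
  rw [hx, RCLike.inner_apply, mul_comm]

theorem inner_testL2_testL2 (φ χ : 𝓓(punctured, ℂ)) :
    ⟪testL2 φ, testL2 χ⟫_ℂ = ∫ x, conj (φ x) * χ x := by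
  rw [inner_testL2]
  refine integral_congr_ae ?_
  filter_upwards [coeFn_testL2 χ] with x hx
  rw [hx]

theorem norm_testL2_sq (φ : 𝓓(punctured, ℂ)) : ‖testL2 φ‖ ^ 2 = ∫ x, ‖φ x‖ ^ 2 := by
  have h : ⟪testL2 φ, testL2 φ⟫_ℂ = ((∫ x, ‖φ x‖ ^ 2 : ℝ) : ℂ) := by
    rw [inner_testL2_testL2, ← integral_complex_ofReal]
    congr 1 with x
    rw [RCLike.conj_mul]
    simp
  have h2 := inner_self_eq_norm_sq_to_K (𝕜 := ℂ) (testL2 φ)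
  rw [h] at h2
  exact Complex.ofReal_injective (by simpa using h2.symm)

theorem isMagGradient_iff {α : ℝ} {ψ : L2} {g : Fin 2 → L2} :
    IsMagGradient α ψ g ↔ ∀ j φ, ⟪testL2 (magTest α j φ), ψ⟫_ℂ = ⟪testL2 φ, g j⟫_ℂ := by
  simp only [IsMagGradient, inner_testL2, coe_magTest]

theorem isHamiltonian_iff {α : ℝ} {ψ η : L2} :
    IsHamiltonian α ψ η ↔
      ∀ φ, ∑ j, ⟪testL2 (magTest α j (magTest α j φ)), ψ⟫_ℂ = ⟪testL2 φ, η⟫_ℂ := by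
  have h : ∀ φ, ∑ j, ⟪testL2 (magTest α j (magTest α j φ)), ψ⟫_ℂ =
      ∫ x, conj (hamiltonian α φ x) * ψ x := by
    intro φ
    rw [← sum_inner, ← map_sum, inner_testL2]
    refine integral_congr_ae (Eventually.of_forall fun x => ?_)
    change conj ((∑ j, magTest α j (magTest α j φ)) x) * ψ x = conj (hamiltonian α φ x) * ψ x
    rw [Fin.sum_univ_two, hamiltonian, Fin.sum_univ_two]
    rfl
  simp only [h]
  simp only [IsHamiltonian, inner_testL2]

theorem testForm_eq (α : ℝ) (φ : 𝓓(punctured, ℂ)) :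
    testForm α φ = ∑ j, ‖testL2 (magTest α j φ)‖ ^ 2 := by
  simp only [testForm, norm_testL2_sq, coe_magTest]

theorem integral_mul_partialDeriv {Ω : TopologicalSpace.Opens Plane} (φ χ : 𝓓(Ω, ℂ)) (j : Fin 2) :
    ∫ x, φ x * partialDeriv j χ x = -∫ x, partialDeriv j φ x * χ x := by
  have hc : ∀ φ : 𝓓(Ω, ℂ), Continuous (partialDeriv j φ) := fun φ =>
    (contDiff_partialDeriv φ.contDiff j).continuous
  refine integral_mul_fderiv_eq_neg_fderiv_mul_of_integrable ?_ ?_ ?_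
    (fun x _ => φ.differentiableAt x) fun x _ => χ.differentiableAt x
  · exact ((hc φ).mul χ.continuous).integrable_of_hasCompactSupport χ.hasCompactSupport.mul_left
  · exact (φ.continuous.mul (hc χ)).integrable_of_hasCompactSupport φ.hasCompactSupport.mul_right
  · exact (φ.continuous.mul χ.continuous).integrable_of_hasCompactSupport
      χ.hasCompactSupport.mul_left

/-- Complex conjugation of test functions. -/
def conjTest {Ω : TopologicalSpace.Opens Plane} (φ : 𝓓(Ω, ℂ)) : 𝓓(Ω, ℂ) where
  toFun x := conj (φ x)
  contDiff' := Complex.conjCLE.contDiff.comp φ.contDiff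
  hasCompactSupport' := φ.hasCompactSupport.comp_left (map_zero _)
  tsupport_subset' := (tsupport_comp_subset (g := (conj : ℂ → ℂ)) (map_zero _) φ).trans φ.tsupport_subset

@[simp]
theorem conjTest_apply {Ω : TopologicalSpace.Opens Plane} (φ : 𝓓(Ω, ℂ)) (x : Plane) :
    conjTest φ x = conj (φ x) := rfl

theorem partialDeriv_conjTest {Ω : TopologicalSpace.Opens Plane} (φ : 𝓓(Ω, ℂ)) (j : Fin 2)
    (x : Plane) : partialDeriv j (conjTest φ) x = conj (partialDeriv j φ x) :=
  partialDeriv_conj (φ.differentiableAt x) j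

/-- Integration by parts moves `-i∂_j` across without boundary terms, and the potential is real. -/
theorem inner_magTest (α : ℝ) (j : Fin 2) (φ χ : 𝓓(punctured, ℂ)) :
    ⟪testL2 (magTest α j φ), testL2 χ⟫_ℂ = ⟪testL2 φ, testL2 (magTest α j χ)⟫_ℂ := by
  rw [inner_testL2_testL2, inner_testL2_testL2, ← sub_eq_zero, ← integral_sub]
  · have h1 : ∀ φ χ : 𝓓(punctured, ℂ), Integrable fun x => φ x * partialDeriv j χ x := fun φ χ =>
      (φ.continuous.mul (contDiff_partialDeriv χ.contDiff j).continuous).integrable_of_hasCompactSupport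
        φ.hasCompactSupport.mul_right
    have h := integral_mul_partialDeriv (conjTest φ) χ j
    have h2 : ∀ x, conj (magTest α j φ x) * χ x - conj (φ x) * magTest α j χ x =
        Complex.I * (conjTest φ x * partialDeriv j χ x) +
          Complex.I * (χ x * partialDeriv j (conjTest φ) x) := by
      intro x
      simp only [coe_magTest, magDeriv, map_add, map_mul, map_neg, Complex.conj_I,
        Complex.conj_ofReal, partialDeriv_conjTest, conjTest_apply]
      ring
    simp only [h2]
    rw [integral_add ((h1 _ _).const_mul _) ((h1 _ _).const_mul _), integral_const_mul,
      integral_const_mul, h]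
    simp only [mul_comm (χ _)]
    ring
  · exact (Continuous.mul (by fun_prop) χ.continuous).integrable_of_hasCompactSupport
      χ.hasCompactSupport.mul_left
  · exact (Continuous.mul (by fun_prop) (magTest α j χ).continuous).integrable_of_hasCompactSupport
      (magTest α j χ).hasCompactSupport.mul_left

theorem ae_ne_zero : ∀ᵐ x : Plane, x ≠ 0 := by
  simp [ae_iff]

/-- The fundamental lemma of the calculus of variations on the punctured plane; the missing origin
is a null set. -/
theorem eq_zero_of_inner_testL2 {f : L2} (hf : ∀ φ, ⟪testL2 φ, f⟫_ℂ = 0) : f = 0 := by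
  have hloc : LocallyIntegrable f := (Lp.memLp f).locallyIntegrable (by norm_num)
  have := punctured.isOpen.ae_eq_zero_of_integral_contDiff_smul_eq_zero (μ := volume)
    (f := f) (hloc.locallyIntegrableOn _) ?_
  · rw [Lp.eq_zero_iff_ae_eq_zero]
    filter_upwards [this, ae_ne_zero] with x hx h0 using hx h0
  · intro g hg hgc hgs
    let φ : 𝓓(punctured, ℂ) :=
      { toFun := fun x => (g x : ℂ)
        contDiff' := Complex.ofRealCLM.contDiff.comp hg
        hasCompactSupport' := hgc.comp_left (g := ((↑) : ℝ → ℂ)) (by simp)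
        tsupport_subset' := (tsupport_comp_subset (g := ((↑) : ℝ → ℂ)) (by simp) g).trans hgs }
    have h := hf φ
    rw [inner_testL2] at h
    rw [← h]
    congr 1 with x
    change g x • f x = conj (g x : ℂ) * f x
    simp

/-! ### The closed magnetic gradient and its graph -/

/-- The closure in `L² × (L²)²` of the graph of `-i∇ + A_α` on `C_c^∞(ℝ² ∖ {0})`. -/
def magGraph (α : ℝ) : Submodule ℂ (WithLp 2 (L2 × PiLp 2 fun _ : Fin 2 => L2)) :=
  (LinearMap.range ((WithLp.linearEquiv 2 ℂ (L2 × PiLp 2 fun _ : Fin 2 => L2)).symm.toLinearMap ∘ₗ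
    testL2.prod ((WithLp.linearEquiv 2 ℂ (Fin 2 → L2)).symm.toLinearMap ∘ₗ
      LinearMap.pi fun j => testL2 ∘ₗ magTest α j))).topologicalClosure

theorem isClosed_magGraph (α : ℝ) : IsClosed (magGraph α : Set (WithLp 2 (L2 × PiLp 2 fun _ : Fin 2 => L2))) :=
  Submodule.isClosed_topologicalClosure _

theorem mem_magGraph_iff {α : ℝ} {ψ : L2} {k : PiLp 2 fun _ : Fin 2 => L2} :
    WithLp.toLp 2 (ψ, k) ∈ magGraph α ↔ ∃ φ : ℕ → 𝓓(punctured, ℂ),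
      Tendsto (fun n => testL2 (φ n)) atTop (𝓝 ψ) ∧
      ∀ j, Tendsto (fun n => testL2 (magTest α j (φ n))) atTop (𝓝 (k j)) := by
  rw [magGraph, ← SetLike.mem_coe, Submodule.topologicalClosure_coe, mem_closure_iff_seq_limit]
  constructor
  · rintro ⟨x, hx, hlim⟩
    choose φ hφ using hx
    have h := ((WithLp.prod_continuous_ofLp 2 L2 (PiLp 2 fun _ : Fin 2 => L2)).tendsto _).comp hlim
    refine ⟨φ, ?_, fun j => ?_⟩
    · have := (continuous_fst.tendsto _).comp h
      refine this.congr fun n => ?_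
      simp [← hφ]
    · have := ((PiLp.continuous_apply 2 (fun _ : Fin 2 => L2) j).tendsto _).comp
        ((continuous_snd.tendsto _).comp h)
      refine this.congr fun n => ?_
      simp [← hφ]
  · rintro ⟨φ, h1, h2⟩
    refine ⟨fun n => WithLp.toLp 2 (testL2 (φ n), WithLp.toLp 2 fun j => testL2 (magTest α j (φ n))),
      fun n => ⟨φ n, rfl⟩, ?_⟩
    refine ((WithLp.prod_continuous_toLp 2 L2 (PiLp 2 fun _ : Fin 2 => L2)).tendsto _).comp
      (h1.prodMk_nhds ?_)
    exact ((PiLp.continuous_toLp 2 (fun _ : Fin 2 => L2)).tendsto k.ofLp).comp (tendsto_pi_nhds.2 h2)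

theorem mem_magGraph_testL2 (α : ℝ) (φ : 𝓓(punctured, ℂ)) :
    WithLp.toLp 2 (testL2 φ, WithLp.toLp 2 fun j => testL2 (magTest α j φ)) ∈ magGraph α :=
  mem_magGraph_iff.2 ⟨fun _ => φ, tendsto_const_nhds, fun _ => tendsto_const_nhds⟩

/-- The symmetry identity `inner_magTest` is continuous in both limits. -/
theorem isMagGradient_of_mem_magGraph {α : ℝ} {ψ : L2} {k : PiLp 2 fun _ : Fin 2 => L2}
    (h : WithLp.toLp 2 (ψ, k) ∈ magGraph α) : IsMagGradient α ψ k := by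
  obtain ⟨φ, h1, h2⟩ := mem_magGraph_iff.1 h
  rw [isMagGradient_iff]
  intro j χ
  refine tendsto_nhds_unique (tendsto_const_nhds.inner h1) ?_
  simp only [inner_magTest]
  exact tendsto_const_nhds.inner (h2 j)

theorem IsMagGradient.unique {α : ℝ} {ψ : L2} {g g' : Fin 2 → L2} (h : IsMagGradient α ψ g)
    (h' : IsMagGradient α ψ g') : g = g' := by
  rw [isMagGradient_iff] at h h'
  funext j
  rw [← sub_eq_zero]
  refine eq_zero_of_inner_testL2 fun φ => ?_
  rw [inner_sub_right, ← h, ← h', sub_self]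

theorem IsMagGradient.magGradient {α : ℝ} {ψ : L2} {g : Fin 2 → L2} (h : IsMagGradient α ψ g) :
    IsMagGradient α ψ (magGradient α ψ) := by
  have h' : ∃ g, IsMagGradient α ψ g := ⟨g, h⟩
  rw [AharonovBohm.magGradient, dif_pos h']
  exact h'.choose_spec

theorem tendsto_eLpNorm_testL2_iff {φ : ℕ → 𝓓(punctured, ℂ)} {ψ : L2} :
    Tendsto (fun n => eLpNorm (fun x => φ n x - ψ x) 2 volume) atTop (𝓝 0) ↔
      Tendsto (fun n => testL2 (φ n)) atTop (𝓝 ψ) := by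
  rw [Lp.tendsto_Lp_iff_tendsto_eLpNorm']
  refine tendsto_congr fun n => eLpNorm_congr_ae ?_
  filter_upwards [coeFn_testL2 (φ n)] with x hx
  simp [hx]

/-- Being Cauchy for `Q_α` means that each component of the magnetic gradients is Cauchy in `L²`,
hence convergent. -/
theorem mem_friedrichsDomain_iff {α : ℝ} {ψ : L2} :
    ψ ∈ friedrichsDomain α ↔ ∃ k, WithLp.toLp 2 (ψ, k) ∈ magGraph α := by
  constructor
  · rintro ⟨φ, h1, h2⟩
    rw [tendsto_eLpNorm_testL2_iff] at h1
    have hlim : ∀ j, ∃ k, Tendsto (fun n => testL2 (magTest α j (φ n))) atTop (𝓝 k) := by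
      intro j
      refine cauchySeq_tendsto_of_complete ?_
      rw [cauchySeq_iff_tendsto_dist_atTop_0]
      have h3 := h2.sqrt
      rw [Real.sqrt_zero] at h3
      refine squeeze_zero (fun _ => dist_nonneg) (fun p => ?_) h3
      rw [dist_eq_norm, ← map_sub, ← map_sub, testForm_eq]
      exact Real.le_sqrt_of_sq_le (Finset.single_le_sum
        (f := fun j => ‖testL2 (magTest α j (φ p.1 - φ p.2))‖ ^ 2) (fun _ _ => sq_nonneg _)
        (Finset.mem_univ j))
    choose k hk using hlim
    exact ⟨WithLp.toLp 2 k, mem_magGraph_iff.2 ⟨φ, h1, hk⟩⟩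
  · rintro ⟨k, hk⟩
    obtain ⟨φ, h1, h2⟩ := mem_magGraph_iff.1 hk
    refine ⟨φ, tendsto_eLpNorm_testL2_iff.2 h1, ?_⟩
    simp only [testForm_eq, map_sub]
    rw [← Finset.sum_const_zero (s := (Finset.univ : Finset (Fin 2)))]
    refine tendsto_finsetSum _ fun j _ => ?_
    have h3 := cauchySeq_iff_tendsto_dist_atTop_0.1 (h2 j).cauchySeq
    simpa [dist_eq_norm] using h3.pow 2

/-- Closability: the second component of a point of the closure is a distributional magnetic
gradient of the first, so it is determined by it. -/
theorem isGraphOf_magGraph (α : ℝ) : IsGraphOf (magGraph α) (friedrichsDomain α)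
    fun ψ => WithLp.toLp 2 (magGradient α ψ) := by
  have key : ∀ {ψ k}, WithLp.toLp 2 (ψ, k) ∈ magGraph α → WithLp.toLp 2 (magGradient α ψ) = k := by
    intro ψ k h
    have h1 := isMagGradient_of_mem_magGraph h
    rw [h1.magGradient.unique h1]
  intro ψ k
  constructor
  · intro h
    exact ⟨mem_friedrichsDomain_iff.2 ⟨k, h⟩, key h⟩
  · rintro ⟨h, rfl⟩
    obtain ⟨k, hk⟩ := mem_friedrichsDomain_iff.1 h
    rwa [← key hk] at hk

theorem friedrichsForm_eq (α : ℝ) (ψ₁ ψ₂ : L2) : friedrichsForm α ψ₁ ψ₂ =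
    ⟪(WithLp.toLp 2 (magGradient α ψ₁) : PiLp 2 fun _ : Fin 2 => L2),
      WithLp.toLp 2 (magGradient α ψ₂)⟫_ℂ := by
  rw [friedrichsForm, PiLp.inner_apply]

theorem isMagGradient_magGradient {α : ℝ} {ψ : L2} (h : ψ ∈ friedrichsDomain α) :
    IsMagGradient α ψ (magGradient α ψ) :=
  isMagGradient_of_mem_magGraph ((isGraphOf_magGraph α).mem h)

theorem testL2_mem_friedrichsDomain (α : ℝ) (φ : 𝓓(punctured, ℂ)) :
    testL2 φ ∈ friedrichsDomain α ∧ magGradient α (testL2 φ) = fun j => testL2 (magTest α j φ) := by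
  have h := (isGraphOf_magGraph α _ _).1 (mem_magGraph_testL2 α φ)
  exact ⟨h.1, (WithLp.toLp_injective 2) h.2⟩

theorem dense_friedrichsDomain (α : ℝ) : Dense (friedrichsDomain α) := by
  have h : Dense (LinearMap.range testL2 : Set L2) := by
    rw [Submodule.dense_iff_topologicalClosure_eq_top, Submodule.topologicalClosure_eq_top_iff,
      Submodule.eq_bot_iff]
    intro f hf
    exact eq_zero_of_inner_testL2 fun φ => (Submodule.mem_orthogonal _ _).1 hf _ ⟨φ, rfl⟩
  refine h.mono ?_
  rintro _ ⟨φ, rfl⟩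
  exact (testL2_mem_friedrichsDomain α φ).1

/-- The Friedrichs form determines `H_α` as a distribution. -/
theorem isHamiltonian_iff_friedrichsForm {α : ℝ} {ψ η : L2} (hψ : ψ ∈ friedrichsDomain α) :
    IsHamiltonian α ψ η ↔ ∀ u ∈ friedrichsDomain α, friedrichsForm α u ψ = ⟪u, η⟫_ℂ := by
  have htest : ∀ φ, friedrichsForm α (testL2 φ) ψ =
      ∑ j, ⟪testL2 (magTest α j (magTest α j φ)), ψ⟫_ℂ := by
    intro φ
    rw [friedrichsForm, (testL2_mem_friedrichsDomain α φ).2]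
    exact Finset.sum_congr rfl fun j _ =>
      (isMagGradient_iff.1 (isMagGradient_magGradient hψ) j (magTest α j φ)).symm
  rw [isHamiltonian_iff]
  constructor
  · intro h u hu
    -- Test functions are a form core, so the identity known on them passes to `u` along a sequence
    -- converging in form norm.
    obtain ⟨φ, h1, h2⟩ := mem_magGraph_iff.1 ((isGraphOf_magGraph α).mem hu)
    have hl : Tendsto (fun n => friedrichsForm α (testL2 (φ n)) ψ) atTop
        (𝓝 (friedrichsForm α u ψ)) := by
      simp only [friedrichsForm]
      refine tendsto_finsetSum _ fun j _ => ?_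
      simp only [(testL2_mem_friedrichsDomain α _).2]
      exact (h2 j).inner tendsto_const_nhds
    refine tendsto_nhds_unique hl ?_
    simp only [htest, h]
    exact h1.inner tendsto_const_nhds
  · intro h φ
    rw [← htest, h _ (testL2_mem_friedrichsDomain α φ).1]


/-! ### A Hardy inequality for the magnetic gradient -/

theorem plane_norm_sq (x : Plane) : ‖x‖ ^ 2 = x 0 ^ 2 + x 1 ^ 2 := by
  simp [EuclideanSpace.norm_sq_eq, Fin.sum_univ_two]

/-- The rotation of the plane by the angle `t`, as a linear map. -/
def rotationAux (t : ℝ) : Plane →ₗ[ℝ] Plane where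
  toFun x := !₂[Real.cos t * x 0 - Real.sin t * x 1, Real.sin t * x 0 + Real.cos t * x 1]
  map_add' x y := by ext i; fin_cases i <;> simp <;> ring
  map_smul' c x := by ext i; fin_cases i <;> simp <;> ring

/-- The rotation of the plane by the angle `t`. -/
def rotation (t : ℝ) : Plane ≃ₗᵢ[ℝ] Plane :=
  LinearIsometry.toLinearIsometryEquiv
    { rotationAux t with
      norm_map' := fun x => by
        have h : ‖rotationAux t x‖ ^ 2 = ‖x‖ ^ 2 := by
          simp only [plane_norm_sq, rotationAux, LinearMap.coe_mk, AddHom.coe_mk]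
          simp
          linear_combination (x 0 ^ 2 + x 1 ^ 2) * Real.sin_sq_add_cos_sq t
        exact (sq_eq_sq₀ (norm_nonneg _) (norm_nonneg _)).1 h } rfl

theorem rotation_apply (t : ℝ) (x : Plane) : rotation t x =
    !₂[Real.cos t * x 0 - Real.sin t * x 1, Real.sin t * x 0 + Real.cos t * x 1] := rfl

@[simp]
theorem rotation_apply_zero (t : ℝ) (x : Plane) :
    rotation t x 0 = Real.cos t * x 0 - Real.sin t * x 1 := rfl

@[simp]
theorem rotation_apply_one (t : ℝ) (x : Plane) :
    rotation t x 1 = Real.sin t * x 0 + Real.cos t * x 1 := rfl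

attribute [irreducible] rotation

theorem continuous_rotation : Continuous fun p : ℝ × Plane => rotation p.1 p.2 := by
  simp only [rotation_apply]
  refine (PiLp.continuous_toLp 2 _).comp (continuous_pi fun i => ?_)
  fin_cases i <;> simp <;> fun_prop

theorem continuous_rotation_left (x : Plane) : Continuous fun t : ℝ => rotation t x :=
  Continuous.comp (g := fun p : ℝ × Plane => rotation p.1 p.2) (f := fun t : ℝ => (t, x))
    continuous_rotation (by fun_prop)

theorem hasDerivAt_rotation (t : ℝ) (x : Plane) :
    HasDerivAt (fun s => rotation s x)
      ((-(rotation t x 1)) • EuclideanSpace.single 0 1 +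
        (rotation t x 0) • EuclideanSpace.single 1 1 : Plane) t := by
  have h : (fun s => rotation s x) = fun s =>
      (Real.cos s * x 0 - Real.sin s * x 1) • (EuclideanSpace.single 0 1 : Plane) +
      (Real.sin s * x 0 + Real.cos s * x 1) • (EuclideanSpace.single 1 1 : Plane) := by
    funext s
    ext i
    fin_cases i <;> simp
  rw [h]
  refine (((((Real.hasDerivAt_cos t).mul_const (x 0)).sub
    ((Real.hasDerivAt_sin t).mul_const (x 1))).smul_const _).add
    ((((Real.hasDerivAt_sin t).mul_const (x 0)).add
    ((Real.hasDerivAt_cos t).mul_const (x 1))).smul_const _)).congr_deriv ?_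
  simp only [rotation_apply_zero, rotation_apply_one]
  congr 2 <;> ring

/-- The angular component `x ∧ (-i∇ + A_α) φ`. -/
def angularDeriv (α : ℝ) (f : Plane → ℂ) (x : Plane) : ℂ :=
  -(x 1 : ℂ) * magDeriv α 0 f x + (x 0 : ℂ) * magDeriv α 1 f x

/-- Cauchy-Schwarz in the plane against `x^⊥`, whose length is `‖x‖`. -/
theorem norm_angularDeriv_sq_le (α : ℝ) (f : Plane → ℂ) (x : Plane) :
    ‖angularDeriv α f x‖ ^ 2 ≤ ‖x‖ ^ 2 * ∑ j, ‖magDeriv α j f x‖ ^ 2 := by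
  rw [plane_norm_sq, Fin.sum_univ_two]
  have h : ‖angularDeriv α f x‖ ≤ |x 1| * ‖magDeriv α 0 f x‖ + |x 0| * ‖magDeriv α 1 f x‖ := by
    refine (norm_add_le _ _).trans_eq ?_
    simp
  refine (pow_le_pow_left₀ (norm_nonneg _) h 2).trans ?_
  rw [← sq_abs (x 0), ← sq_abs (x 1)]
  nlinarith [sq_nonneg (|x 0| * ‖magDeriv α 0 f x‖ - |x 1| * ‖magDeriv α 1 f x‖)]

/-- Since `x^⊥ · A_α(x) = α`, the potential enters the angular derivative only through the constant
`iα`. -/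
theorem fderiv_angular (α : ℝ) (f : Plane → ℂ) {x : Plane} (hx : x ≠ 0) :
    fderiv ℝ f x ((-(x 1)) • EuclideanSpace.single 0 1 + (x 0) • EuclideanSpace.single 1 1) +
      Complex.I * α * f x = Complex.I * angularDeriv α f x := by
  have hn : (x 0 : ℂ) ^ 2 + (x 1 : ℂ) ^ 2 ≠ 0 := by
    have : ‖x‖ ^ 2 ≠ 0 := pow_ne_zero 2 (norm_ne_zero_iff.2 hx)
    rw [plane_norm_sq] at this
    exact_mod_cast this
  rw [map_add, map_smul, map_smul]
  simp only [angularDeriv, magDeriv, potential_zero, potential_one, plane_norm_sq, partialDeriv,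
    Complex.real_smul]
  push_cast
  field_simp
  ring_nf
  simp only [Complex.I_sq]
  ring

/-- The factor `e^{iαs}` gauges away the constant `iα` along the circle through `x`. -/
theorem hasDerivAt_phase_mul_rotation (α : ℝ) {f : Plane → ℂ} (hf : Differentiable ℝ f) {x : Plane}
    (hx : x ≠ 0) (t : ℝ) :
    HasDerivAt (fun s : ℝ => Complex.exp (Complex.I * α * s) * f (rotation s x))
      (Complex.exp (Complex.I * α * t) * (Complex.I * angularDeriv α f (rotation t x))) t := by
  have h1 : HasDerivAt (fun s : ℝ => Complex.exp (Complex.I * α * s))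
      (Complex.exp (Complex.I * α * t) * (Complex.I * α)) t := by
    have := ((Complex.ofRealCLM.hasDerivAt (x := t)).const_mul (Complex.I * α)).cexp
    simpa using this
  have h2 := (hf (rotation t x)).hasFDerivAt.comp_hasDerivAt t (hasDerivAt_rotation t x)
  refine (h1.mul h2).congr_deriv ?_
  rw [← fderiv_angular α f (by simpa using hx), Function.comp_apply]
  ring

theorem norm_phase (α t : ℝ) : ‖Complex.exp (Complex.I * α * t)‖ = 1 := by
  rw [show Complex.I * α * t = ((α * t : ℝ) : ℂ) * Complex.I by push_cast; ring]
  exact Complex.norm_exp_ofReal_mul_I _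

/-- The defect of the phase `e^{iαt}` after one turn. -/
def phaseDefect (α : ℝ) : ℝ := ‖Complex.exp (Complex.I * α * (2 * Real.pi : ℝ)) - 1‖

/-- If the defect vanished, `α` would be an integer, and there is none strictly between `0` and `1`.
-/
theorem phaseDefect_pos {α : ℝ} (hα₀ : 0 < α) (hα₁ : α < 1) : 0 < phaseDefect α := by
  rw [phaseDefect, norm_pos_iff, sub_ne_zero]
  intro h
  obtain ⟨n, hn⟩ := Complex.exp_eq_one_iff.1 h
  have h2 : (α : ℂ) = n := by
    have h3 : (2 * Real.pi * Complex.I : ℂ) ≠ 0 := Complex.two_pi_I_ne_zero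
    apply mul_right_cancel₀ h3
    rw [← hn]
    push_cast
    ring
  have h4 : α = n := by exact_mod_cast h2
  rw [h4] at hα₀ hα₁
  have h5 : 0 < n := by exact_mod_cast hα₀
  have h6 : n < 1 := by exact_mod_cast hα₁
  omega

theorem continuous_angularDeriv (α : ℝ) (φ : 𝓓(punctured, ℂ)) : Continuous (angularDeriv α φ) := by
  have h : ∀ j, Continuous (magDeriv α j φ) := fun j => (magTest α j φ).continuous
  have hc : ∀ i, Continuous fun x : Plane => x i := fun i =>
    (EuclideanSpace.proj (𝕜 := ℝ) i : Plane →L[ℝ] ℝ).continuous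
  exact ((Complex.continuous_ofReal.comp (hc 1)).neg.mul (h 0)).add
    ((Complex.continuous_ofReal.comp (hc 0)).mul (h 1))

/-- The fundamental theorem of calculus over one full turn: `φ` returns to its value at `x`, the
phase does not return to `1`. -/
theorem phaseDefect_mul_norm_le (α : ℝ) (φ : 𝓓(punctured, ℂ)) {x : Plane} (hx : x ≠ 0) :
    phaseDefect α * ‖φ x‖ ≤ ∫ t in (0 : ℝ)..2 * Real.pi, ‖angularDeriv α φ (rotation t x)‖ := by
  have hrot : Continuous fun t : ℝ => rotation t x := continuous_rotation_left x
  have hcont := (continuous_angularDeriv α φ).comp hrot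
  have h := intervalIntegral.integral_eq_sub_of_hasDerivAt (a := 0) (b := 2 * Real.pi)
    (fun t _ => hasDerivAt_phase_mul_rotation α (fun y => φ.differentiableAt y) hx t)
    (Continuous.intervalIntegrable
      ((by fun_prop : Continuous fun t : ℝ => Complex.exp (Complex.I * α * t)).mul
        (continuous_const.mul hcont)) _ _)
  have hr : rotation (2 * Real.pi) x = x ∧ rotation 0 x = x := by
    constructor <;> ext i <;> fin_cases i <;> simp
  rw [hr.1, hr.2] at h
  have h2 : phaseDefect α * ‖φ x‖ = ‖Complex.exp (Complex.I * α * (2 * Real.pi : ℝ)) * φ x -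
      Complex.exp (Complex.I * α * (0 : ℝ)) * φ x‖ := by
    rw [phaseDefect, ← norm_mul]
    congr 1
    simp
    ring
  rw [h2, ← h]
  refine (intervalIntegral.norm_integral_le_integral_norm Real.two_pi_pos.le).trans_eq ?_
  refine intervalIntegral.integral_congr fun t _ => ?_
  simp only [norm_mul, norm_phase, Complex.norm_I, one_mul]

/-- The Cauchy-Schwarz inequality on an interval, against the constant function. -/
theorem sq_le_mul_integral_sq {f : ℝ → ℝ} (hf : Continuous f) {L m : ℝ} (hL : 0 < L) (hm : 0 ≤ m)
    (h : m ≤ ∫ t in (0 : ℝ)..L, f t) : m ^ 2 ≤ L * ∫ t in (0 : ℝ)..L, f t ^ 2 := by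
  -- Expanding the square around `m / L` instead of the mean of `f` leaves a term where only the
  -- lower bound on `∫ f` is needed.
  have h0 : 0 ≤ ∫ t in (0 : ℝ)..L, (f t - m / L) ^ 2 :=
    intervalIntegral.integral_nonneg hL.le fun _ _ => sq_nonneg _
  have h1 : ∫ t in (0 : ℝ)..L, (f t - m / L) ^ 2 =
      (∫ t in (0 : ℝ)..L, f t ^ 2) - 2 * (m / L) * (∫ t in (0 : ℝ)..L, f t) + m ^ 2 / L := by
    have e : ∀ t, (f t - m / L) ^ 2 = f t ^ 2 - 2 * (m / L) * f t + (m / L) ^ 2 := fun t => by ring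
    simp only [e]
    rw [intervalIntegral.integral_add, intervalIntegral.integral_sub,
      intervalIntegral.integral_const_mul, intervalIntegral.integral_const]
    · simp only [sub_zero, smul_eq_mul]
      field_simp
    all_goals exact Continuous.intervalIntegrable (by fun_prop) _ _
  rw [h1] at h0
  have h2 : m / L * m ≤ m / L * ∫ t in (0 : ℝ)..L, f t := by gcongr
  have h3 : 0 ≤ L * ((∫ t in (0 : ℝ)..L, f t ^ 2) - 2 * (m / L * m) + m ^ 2 / L) := by
    apply mul_nonneg hL.le
    linarith
  have h4 : L * ((∫ t in (0 : ℝ)..L, f t ^ 2) - 2 * (m / L * m) + m ^ 2 / L) =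
    L * (∫ t in (0 : ℝ)..L, f t ^ 2) - m ^ 2 := by field_simp; ring
  linarith

/-- Cauchy-Schwarz on the circle produces the factor `2π`; rotations preserve `‖x‖`, so the weight
`‖x‖²` leaves the integral and is divided out. -/
theorem phaseDefect_sq_mul_le (α : ℝ) (φ : 𝓓(punctured, ℂ)) {x : Plane} (hx : x ≠ 0) :
    phaseDefect α ^ 2 * (‖φ x‖ ^ 2 / ‖x‖ ^ 2) ≤ 2 * Real.pi *
      ∫ t in (0 : ℝ)..2 * Real.pi, ∑ j, ‖magDeriv α j φ (rotation t x)‖ ^ 2 := by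
  have hrot : Continuous fun t : ℝ => rotation t x := continuous_rotation_left x
  have hcont := (continuous_angularDeriv α φ).comp hrot
  have hj : ∀ j, Continuous (magDeriv α j φ) := fun j => (magTest α j φ).continuous
  have h := sq_le_mul_integral_sq hcont.norm Real.two_pi_pos
    (mul_nonneg (norm_nonneg _) (norm_nonneg _)) (phaseDefect_mul_norm_le α φ hx)
  have hmono : ∫ t in (0 : ℝ)..2 * Real.pi, ‖angularDeriv α φ (rotation t x)‖ ^ 2 ≤
      ∫ t in (0 : ℝ)..2 * Real.pi, ‖x‖ ^ 2 * ∑ j, ‖magDeriv α j φ (rotation t x)‖ ^ 2 := by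
    refine intervalIntegral.integral_mono_on Real.two_pi_pos.le
      ((hcont.norm.pow 2).intervalIntegrable _ _) ?_ fun t _ => ?_
    · exact Continuous.intervalIntegrable (continuous_const.mul
        (continuous_finsetSum _ fun j _ => ((hj j).comp hrot).norm.pow 2)) _ _
    · simpa using norm_angularDeriv_sq_le α φ (rotation t x)
  rw [intervalIntegral.integral_const_mul] at hmono
  have hx' : 0 < ‖x‖ ^ 2 := pow_pos (norm_pos_iff.2 hx) 2
  rw [← mul_div_assoc, div_le_iff₀ hx', ← mul_pow]
  refine h.trans ?_
  refine (mul_le_mul_of_nonneg_left hmono Real.two_pi_pos.le).trans_eq ?_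
  ring

/-- Tonelli and the invariance of Lebesgue measure under rotations; this turns a bound on circles
into one on the plane. -/
theorem lintegral_lintegral_rotation {N : Plane → ℝ} (hN : Continuous N) (L : ℝ) :
    ∫⁻ x, ∫⁻ t in Set.Ioc 0 L, ENNReal.ofReal (N (rotation t x)) =
      ENNReal.ofReal L * ∫⁻ x, ENNReal.ofReal (N x) := by
  have hm : Measurable fun p : Plane × ℝ => ENNReal.ofReal (N (rotation p.2 p.1)) :=
    (hN.comp (Continuous.comp (g := fun p : ℝ × Plane => rotation p.1 p.2) (f := Prod.swap)
      continuous_rotation continuous_swap)).measurable.ennreal_ofReal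
  rw [lintegral_lintegral_swap hm.aemeasurable]
  have hrotint : ∀ t, ∫⁻ x, ENNReal.ofReal (N (rotation t x)) = ∫⁻ x, ENNReal.ofReal (N x) :=
    fun t => (rotation t).measurePreserving.lintegral_comp hN.measurable.ennreal_ofReal
  simp only [hrotint]
  rw [setLIntegral_const, Real.volume_Ioc, sub_zero, mul_comm]

theorem lintegral_sum_norm_magDeriv_sq (α : ℝ) (φ : 𝓓(punctured, ℂ)) :
    ∫⁻ x, ENNReal.ofReal (∑ j, ‖magDeriv α j φ x‖ ^ 2) = ENNReal.ofReal (testForm α φ) := by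
  have hint : ∀ j, Integrable fun x => ‖magDeriv α j φ x‖ ^ 2 := fun j =>
    (memLp_two_iff_integrable_sq_norm (magTest α j φ).continuous.aestronglyMeasurable).1
      (memLp_testFunction (magTest α j φ))
  have h : Integrable fun x => ∑ j, ‖magDeriv α j φ x‖ ^ 2 :=
    integrable_finsetSum Finset.univ fun j _ => hint j
  have h' : testForm α φ = ∫ x, ∑ j, ‖magDeriv α j φ x‖ ^ 2 :=
    (integral_finsetSum Finset.univ fun j _ => hint j).symm
  rw [h', ofReal_integral_eq_lintegral_ofReal h]
  exact Eventually.of_forall fun x => Finset.sum_nonneg fun j _ => sq_nonneg _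

/-- Hardy inequality for the Aharonov-Bohm magnetic gradient. -/
theorem lintegral_hardy (α : ℝ) (φ : 𝓓(punctured, ℂ)) :
    ∫⁻ x, ENNReal.ofReal (phaseDefect α ^ 2 * (‖φ x‖ ^ 2 / ‖x‖ ^ 2)) ≤
      ENNReal.ofReal ((2 * Real.pi) ^ 2 * testForm α φ) := by
  have hNc : Continuous fun x => ∑ j, ‖magDeriv α j φ x‖ ^ 2 :=
    continuous_finsetSum _ fun j _ => (magTest α j φ).continuous.norm.pow 2
  have hpt : ∀ᵐ x : Plane, ENNReal.ofReal (phaseDefect α ^ 2 * (‖φ x‖ ^ 2 / ‖x‖ ^ 2)) ≤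
      ENNReal.ofReal (2 * Real.pi) * ∫⁻ t in Set.Ioc 0 (2 * Real.pi),
        ENNReal.ofReal (∑ j, ‖magDeriv α j φ (rotation t x)‖ ^ 2) := by
    filter_upwards [ae_ne_zero] with x hx
    have hrot := hNc.comp (continuous_rotation_left x)
    rw [← ofReal_integral_eq_lintegral_ofReal, ← intervalIntegral.integral_of_le Real.two_pi_pos.le,
      ← ENNReal.ofReal_mul Real.two_pi_pos.le]
    · exact ENNReal.ofReal_le_ofReal (phaseDefect_sq_mul_le α φ hx)
    · exact (hrot.intervalIntegrable 0 (2 * Real.pi)).1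
    · exact Eventually.of_forall fun t => Finset.sum_nonneg fun j _ => sq_nonneg _
  -- The second factor `2π` is the length of the `t`-interval after swapping the integrals.
  refine (lintegral_mono_ae hpt).trans_eq ?_
  rw [lintegral_const_mul' _ _ ENNReal.ofReal_ne_top, lintegral_lintegral_rotation hNc,
    lintegral_sum_norm_magDeriv_sq, ← ENNReal.ofReal_mul Real.two_pi_pos.le,
    ← ENNReal.ofReal_mul Real.two_pi_pos.le, ← mul_assoc, ← sq]


/-! ### The form domain is contained in the weighted Sobolev space -/

theorem potential_sq_le (α : ℝ) (j : Fin 2) (x : Plane) :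
    potential α x j ^ 2 ≤ α ^ 2 / ‖x‖ ^ 2 := by
  by_cases hx : x = 0
  · simp [hx, potential]
  have hn : 0 < ‖x‖ ^ 2 := pow_pos (norm_pos_iff.2 hx) 2
  have key : ∀ a : ℝ, a ^ 2 ≤ ‖x‖ ^ 2 → (α * a / ‖x‖ ^ 2) ^ 2 ≤ α ^ 2 / ‖x‖ ^ 2 := by
    intro a ha
    rw [div_pow, sq (‖x‖ ^ 2), ← div_div, mul_pow]
    refine div_le_div_of_nonneg_right ?_ hn.le
    rw [div_le_iff₀ hn]
    exact mul_le_mul_of_nonneg_left ha (sq_nonneg α)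
  have h := plane_norm_sq x
  fin_cases j
  · simp only [Fin.zero_eta, potential_zero, neg_sq]
    exact key _ (by nlinarith [sq_nonneg (x 0)])
  · simp only [Fin.mk_one, potential_one]
    exact key _ (by nlinarith [sq_nonneg (x 1)])

/-- Multiplication by a component of the potential on `C_c^∞(ℝ² ∖ {0})`. -/
def potTest (α : ℝ) (j : Fin 2) : 𝓓(punctured, ℂ) →ₗ[ℂ] 𝓓(punctured, ℂ) where
  toFun φ :=
    { toFun := fun x => (potential α x j : ℂ) * φ x
      contDiff' := contDiff_of_tsupport_subset_punctured
        ((tsupport_mul_subset_right (f := fun x => (potential α x j : ℂ))).trans φ.tsupport_subset)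
        fun x hx => (Complex.ofRealCLM.contDiff.contDiffAt.comp x (contDiffAt_potential α j hx)).mul
          φ.contDiff.contDiffAt
      hasCompactSupport' := φ.hasCompactSupport.mul_left
      tsupport_subset' :=
        (tsupport_mul_subset_right (f := fun x => (potential α x j : ℂ))).trans φ.tsupport_subset }
  map_add' φ χ := by
    ext x
    exact mul_add _ _ _
  map_smul' c φ := by
    ext x
    exact mul_left_comm _ _ _

theorem potTest_apply (α : ℝ) (j : Fin 2) (φ : 𝓓(punctured, ℂ)) (x : Plane) :
    potTest α j φ x = (potential α x j : ℂ) * φ x := rfl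

theorem partialDeriv_eq_magTest_sub_potTest (α : ℝ) (j : Fin 2) (φ : 𝓓(punctured, ℂ)) (x : Plane) :
    partialDeriv j φ x = (Complex.I • (magTest α j φ - potTest α j φ)) x := by
  change _ = Complex.I * (magDeriv α j φ x - (potential α x j : ℂ) * φ x)
  rw [magDeriv]
  linear_combination partialDeriv j φ x * Complex.I_sq

/-- The Hardy inequality combined with `potential_sq_le`. -/
theorem norm_testL2_potTest_le (α : ℝ) (j : Fin 2) (φ : 𝓓(punctured, ℂ)) :
    phaseDefect α ^ 2 * ‖testL2 (potTest α j φ)‖ ^ 2 ≤ (2 * Real.pi * α) ^ 2 * testForm α φ := by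
  have h0 : 0 ≤ testForm α φ := by
    rw [testForm_eq]
    exact Finset.sum_nonneg fun j _ => sq_nonneg _
  have hint : Integrable fun x => ‖potTest α j φ x‖ ^ 2 :=
    (memLp_two_iff_integrable_sq_norm (potTest α j φ).continuous.aestronglyMeasurable).1
      (memLp_testFunction (potTest α j φ))
  rw [norm_testL2_sq, ← integral_const_mul,
    ← ENNReal.ofReal_le_ofReal_iff (mul_nonneg (sq_nonneg _) h0),
    ofReal_integral_eq_lintegral_ofReal (hint.const_mul _)
      (Eventually.of_forall fun x => by positivity)]
  have h := mul_le_mul_right (lintegral_hardy α φ) (ENNReal.ofReal (α ^ 2))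
  rw [← lintegral_const_mul' _ _ ENNReal.ofReal_ne_top, ← ENNReal.ofReal_mul (sq_nonneg α)] at h
  refine (lintegral_mono fun x => ?_).trans (h.trans_eq ?_)
  · rw [← ENNReal.ofReal_mul (sq_nonneg α)]
    refine ENNReal.ofReal_le_ofReal ?_
    rw [potTest_apply, norm_mul, mul_pow, Complex.norm_real, Real.norm_eq_abs, sq_abs]
    calc phaseDefect α ^ 2 * (potential α x j ^ 2 * ‖φ x‖ ^ 2)
        ≤ phaseDefect α ^ 2 * (α ^ 2 / ‖x‖ ^ 2 * ‖φ x‖ ^ 2) := by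
          gcongr
          exact potential_sq_le α j x
      _ = _ := by ring
  · congr 1
    ring

/-- `L²` limits commute with multiplication by a function. -/
theorem coeFn_eq_mul_of_tendsto {a : Plane → ℂ} {u v : ℕ → L2} {f g : L2}
    (hu : Tendsto u atTop (𝓝 f)) (hv : Tendsto v atTop (𝓝 g))
    (h : ∀ n, v n =ᵐ[volume] fun x => a x * u n x) : g =ᵐ[volume] fun x => a x * f x := by
  -- Extract a subsequence along which `u` converges almost everywhere, then a further one for `v`.
  obtain ⟨ns, hns, h1⟩ := (tendstoInMeasure_of_tendsto_Lp hu).exists_seq_tendsto_ae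
  obtain ⟨ms, hms, h2⟩ :=
    (tendstoInMeasure_of_tendsto_Lp (hv.comp hns.tendsto_atTop)).exists_seq_tendsto_ae
  filter_upwards [h1, h2, ae_all_iff.2 h] with x hx1 hx2 hx
  refine tendsto_nhds_unique hx2 ?_
  simp only [Function.comp_apply, hx]
  exact (hx1.comp hms.tendsto_atTop).const_mul _

theorem inner_toLp {f : Plane → ℂ} (hf : MemLp f 2 (volume : Measure Plane)) (g : L2) :
    ⟪hf.toLp f, g⟫_ℂ = ∫ x, conj (f x) * g x := by
  rw [L2.inner_def]
  refine integral_congr_ae ?_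
  filter_upwards [hf.coeFn_toLp] with x hx
  rw [hx, RCLike.inner_apply, mul_comm]

theorem tendsto_integral_mul {f : Plane → ℂ} (hf : MemLp f 2 (volume : Measure Plane)) {u : ℕ → L2}
    {g : L2} (hu : Tendsto u atTop (𝓝 g)) :
    Tendsto (fun n => ∫ x, f x * u n x) atTop (𝓝 (∫ x, f x * g x)) := by
  have hf' : MemLp (fun x => conj (f x)) 2 (volume : Measure Plane) :=
    hf.star
  have h : ∀ g : L2, ∫ x, f x * g x = ⟪hf'.toLp _, g⟫_ℂ := fun g => by
    simp only [inner_toLp, Complex.conj_conj]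
  simp only [h]
  exact tendsto_const_nhds.inner hu

/-- A test function on the punctured plane, as a test function on the plane. -/
def extendTest (φ : 𝓓(punctured, ℂ)) : 𝓓((⊤ : TopologicalSpace.Opens Plane), ℂ) where
  toFun := φ
  contDiff' := φ.contDiff
  hasCompactSupport' := φ.hasCompactSupport
  tsupport_subset' := fun _ _ => trivial

theorem memLp_partialDeriv {Ω : TopologicalSpace.Opens Plane} (φ : 𝓓(Ω, ℂ)) (j : Fin 2) :
    MemLp (partialDeriv j φ) 2 (volume : Measure Plane) :=
  (contDiff_partialDeriv φ.contDiff j).continuous.memLp_of_hasCompactSupport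
    (φ.hasCompactSupport.of_isClosed_subset (isClosed_tsupport _)
      (tsupport_partialDeriv_subset j φ))

/-- Applied to differences, the Hardy bound makes `A_α φ_n` Cauchy as soon as the magnetic gradients
are; positivity of the phase defect allows the division. -/
theorem exists_tendsto_potTest {α : ℝ} (hα₀ : 0 < α) (hα₁ : α < 1) {φ : ℕ → 𝓓(punctured, ℂ)}
    {k : Fin 2 → L2} (h : ∀ j, Tendsto (fun n => testL2 (magTest α j (φ n))) atTop (𝓝 (k j)))
    (j : Fin 2) : ∃ a, Tendsto (fun n => testL2 (potTest α j (φ n))) atTop (𝓝 a) := by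
  have hc := phaseDefect_pos hα₀ hα₁
  refine cauchySeq_tendsto_of_complete ?_
  rw [cauchySeq_iff_tendsto_dist_atTop_0]
  have h2 : Tendsto (fun p : ℕ × ℕ => testForm α (φ p.1 - φ p.2)) atTop (𝓝 0) := by
    simp only [testForm_eq, map_sub]
    rw [← Finset.sum_const_zero (s := (Finset.univ : Finset (Fin 2)))]
    refine tendsto_finsetSum _ fun j _ => ?_
    have h3 := cauchySeq_iff_tendsto_dist_atTop_0.1 (h j).cauchySeq
    simpa [dist_eq_norm] using h3.pow 2
  have h3 := (h2.const_mul ((2 * Real.pi * α) ^ 2 / phaseDefect α ^ 2)).sqrt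
  rw [mul_zero, Real.sqrt_zero] at h3
  refine squeeze_zero (fun _ => dist_nonneg) (fun p => ?_) h3
  rw [dist_eq_norm, ← map_sub, ← map_sub]
  refine Real.le_sqrt_of_sq_le ?_
  rw [div_mul_eq_mul_div, le_div_iff₀ (pow_pos hc 2), mul_comm]
  exact norm_testL2_potTest_le α j _

/-- Both `(-i∇ + A_α) φ_n` and `A_α φ_n` converge in `L²`, hence so does `∇φ_n`. Each `φ_n` is
smooth on the whole plane, so integration by parts against `χ` sees no contribution from the origin,
and the limit is a weak derivative on all of `ℝ²`. -/
theorem memH1_and_memLp_of_mem_friedrichsDomain {α : ℝ} (hα₀ : 0 < α) (hα₁ : α < 1) {ψ : L2}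
    (hψ : ψ ∈ friedrichsDomain α) : MemH1 ψ ∧
      ∀ j : Fin 2, MemLp (fun x : Plane => (potential α x j : ℂ) * ψ x) 2 volume := by
  obtain ⟨φ, h1, h2⟩ := mem_magGraph_iff.1 ((isGraphOf_magGraph α).mem hψ)
  choose a ha using exists_tendsto_potTest hα₀ hα₁ h2
  constructor
  · refine ⟨fun j => Complex.I • (magGradient α ψ j - a j), fun j χ => ?_⟩
    have hd : Tendsto (fun n => testL2 (Complex.I • (magTest α j (φ n) - potTest α j (φ n)))) atTop
        (𝓝 (Complex.I • (magGradient α ψ j - a j))) := by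
      simp only [map_smul, map_sub]
      exact ((h2 j).sub (ha j)).const_smul Complex.I
    refine tendsto_nhds_unique (tendsto_integral_mul (memLp_partialDeriv χ j) h1) ?_
    refine (tendsto_integral_mul (memLp_testFunction χ) hd).neg.congr fun n => ?_
    have e1 : ∫ x, partialDeriv j χ x * testL2 (φ n) x =
        ∫ x, partialDeriv j χ x * extendTest (φ n) x := by
      refine integral_congr_ae ?_
      filter_upwards [coeFn_testL2 (φ n)] with x hx
      rw [hx]
      rfl
    rw [e1, neg_eq_iff_eq_neg, ← integral_mul_partialDeriv χ (extendTest (φ n)) j]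
    refine integral_congr_ae ?_
    filter_upwards [coeFn_testL2 (Complex.I • (magTest α j (φ n) - potTest α j (φ n)))] with x hx
    rw [hx, ← partialDeriv_eq_magTest_sub_potTest]
    rfl
  · intro j
    have h := coeFn_eq_mul_of_tendsto (a := fun x => (potential α x j : ℂ)) h1 (ha j) fun n => by
      filter_upwards [coeFn_testL2 (φ n), coeFn_testL2 (potTest α j (φ n))] with x hx1 hx2
      rw [hx2, hx1, potTest_apply]
    exact (memLp_congr_ae h).1 (Lp.memLp (a j))


/-! ### Mollification in `L²` -/

open scoped Convolution

theorem eLpNorm_two_sq {X F : Type*} [MeasurableSpace X] [NormedAddCommGroup F] (f : X → F)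
    (μ : Measure X) : eLpNorm f 2 μ ^ 2 = ∫⁻ x, ‖f x‖ₑ ^ 2 ∂μ := by
  have := eLpNorm_nnreal_pow_eq_lintegral (f := f) (μ := μ) (p := 2) two_ne_zero
  simpa using this

theorem tendsto_eLpNorm_translate (f : L2) :
    Tendsto (fun t : Plane => eLpNorm (fun x => f (x - t) - f x) 2 volume) (𝓝 0) (𝓝 0) := by
  have : Fact ((2 : ENNReal) ≠ ⊤) := ⟨ENNReal.ofNat_ne_top⟩
  have h1 : Continuous fun t : Plane => DomAddAct.mk (-t) +ᵥ f :=
    (DomAddAct.continuous_mk.comp continuous_neg).vadd continuous_const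
  have h2 := h1.tendsto 0
  rw [neg_zero] at h2
  have h3 : (DomAddAct.mk (0 : Plane) +ᵥ f) = f := zero_vadd _ f
  rw [h3, Lp.tendsto_Lp_iff_tendsto_eLpNorm'] at h2
  refine h2.congr fun t => eLpNorm_congr_ae ?_
  filter_upwards [DomAddAct.vadd_Lp_ae_eq (DomAddAct.mk (-t)) f] with x hx
  simp only [Pi.sub_apply, hx]
  congr 2
  simp [sub_eq_neg_add]

/-- Minkowski's integral inequality for a probability measure: bound the `L¹(ν)` norm by the `L²(ν)`
norm for each `x`, then swap the integrals. -/
theorem eLpNorm_integral_translate_le {f : Plane → ℂ} (hf : StronglyMeasurable f)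
    (ν : Measure Plane) [IsProbabilityMeasure ν] {ε : ENNReal}
    (h : ∀ᵐ t ∂ν, eLpNorm (fun x => f (x - t) - f x) 2 volume ≤ ε) :
    eLpNorm (fun x => ∫ t, (f (x - t) - f x) ∂ν) 2 volume ≤ ε := by
  have hmeas : StronglyMeasurable fun p : Plane × Plane => f (p.1 - p.2) - f p.1 :=
    (hf.comp_measurable (measurable_fst.sub measurable_snd)).sub (hf.comp_measurable measurable_fst)
  have hsec : ∀ x, AEStronglyMeasurable (fun t => f (x - t) - f x) ν := fun x =>
    (hmeas.comp_measurable (measurable_const.prodMk measurable_id)).aestronglyMeasurable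
  rw [← ENNReal.pow_le_pow_left_iff two_ne_zero, eLpNorm_two_sq]
  calc ∫⁻ x, ‖∫ t, (f (x - t) - f x) ∂ν‖ₑ ^ 2
      ≤ ∫⁻ x, ∫⁻ t, ‖f (x - t) - f x‖ₑ ^ 2 ∂ν := by
        refine lintegral_mono fun x => ?_
        rw [← eLpNorm_two_sq]
        refine pow_le_pow_left' ?_ 2
        refine (enorm_integral_le_lintegral_enorm _).trans ?_
        rw [← eLpNorm_one_eq_lintegral_enorm]
        exact eLpNorm_le_eLpNorm_of_exponent_le one_le_two (hsec x)
    _ = ∫⁻ t, (∫⁻ x, ‖f (x - t) - f x‖ₑ ^ 2) ∂ν :=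
        lintegral_lintegral_swap (hmeas.enorm.pow_const 2).aemeasurable
    _ ≤ ∫⁻ _, ε ^ 2 ∂ν := by
        refine lintegral_mono_ae ?_
        filter_upwards [h] with t ht
        rw [← eLpNorm_two_sq]
        exact pow_le_pow_left' ht 2
    _ = ε ^ 2 := by simp

/-- The mollification of `f` by a normalized bump function. -/
def mollify (b : ContDiffBump (0 : Plane)) (f : L2) : Plane → ℂ :=
  b.normed volume ⋆[ContinuousLinearMap.lsmul ℝ ℝ, volume] (f : Plane → ℂ)

theorem mollify_apply (b : ContDiffBump (0 : Plane)) (f : L2) (x : Plane) :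
    mollify b f x = ∫ t, b.normed volume t • f (x - t) := rfl

theorem mollify_apply' (b : ContDiffBump (0 : Plane)) (f : L2) (x : Plane) :
    mollify b f x = ∫ t, b.normed volume (x - t) • f t := convolution_lsmul_swap

theorem locallyIntegrable_L2 (f : L2) : LocallyIntegrable f (volume : Measure Plane) :=
  (Lp.memLp f).locallyIntegrable (by norm_num)

theorem contDiff_mollify (b : ContDiffBump (0 : Plane)) (f : L2) :
    ContDiff ℝ (⊤ : ℕ∞) (mollify b f) :=
  b.hasCompactSupport_normed.contDiff_convolution_left _ b.contDiff_normed (locallyIntegrable_L2 f)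

/-- The probability measure with density a normalized bump function. -/
def bumpMeasure (b : ContDiffBump (0 : Plane)) : Measure Plane :=
  volume.withDensity fun t => ENNReal.ofReal (b.normed volume t)

instance (b : ContDiffBump (0 : Plane)) : IsProbabilityMeasure (bumpMeasure b) := by
  refine ⟨?_⟩
  rw [bumpMeasure, withDensity_apply _ MeasurableSet.univ, setLIntegral_univ,
    ← ofReal_integral_eq_lintegral_ofReal b.integrable_normed
      (Eventually.of_forall b.nonneg_normed), b.integral_normed, ENNReal.ofReal_one]

theorem integral_bumpMeasure (b : ContDiffBump (0 : Plane)) (g : Plane → ℂ) :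
    ∫ t, g t ∂bumpMeasure b = ∫ t, b.normed volume t • g t := by
  rw [bumpMeasure, integral_withDensity_eq_integral_toReal_smul
    b.continuous_normed.measurable.ennreal_ofReal (by simp)]
  simp only [ENNReal.toReal_ofReal (b.nonneg_normed _)]

theorem mollify_sub_apply (b : ContDiffBump (0 : Plane)) (f : L2) (x : Plane) :
    mollify b f x - f x = ∫ t, (f (x - t) - f x) ∂bumpMeasure b := by
  have h1 : Integrable fun t => b.normed volume t • f (x - t) :=
    b.hasCompactSupport_normed.convolutionExists_left (ContinuousLinearMap.lsmul ℝ ℝ)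
      b.continuous_normed (locallyIntegrable_L2 f) x
  simp only [integral_bumpMeasure, smul_sub]
  rw [integral_sub h1 (b.integrable_normed.smul_const _), b.integral_normed_smul, mollify_apply]

theorem ae_bumpMeasure_mem_ball (b : ContDiffBump (0 : Plane)) :
    ∀ᵐ t ∂bumpMeasure b, t ∈ Metric.ball (0 : Plane) b.rOut := by
  rw [bumpMeasure, ae_withDensity_iff b.continuous_normed.measurable.ennreal_ofReal]
  refine Eventually.of_forall fun t ht => ?_
  rw [← b.support_normed_eq (μ := volume)]
  intro h0
  exact ht (by rw [h0, ENNReal.ofReal_zero])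

/-- The error is an average of translation errors over shifts shorter than `rOut`, and translation
is continuous in `L²`. -/
theorem tendsto_eLpNorm_mollify {b : ℕ → ContDiffBump (0 : Plane)}
    (hb : Tendsto (fun n => (b n).rOut) atTop (𝓝 0)) (f : L2) :
    Tendsto (fun n => eLpNorm (fun x => mollify (b n) f x - f x) 2 volume) atTop (𝓝 0) := by
  rw [ENNReal.tendsto_nhds_zero]
  intro ε hε
  obtain ⟨δ, hδ, hball⟩ := Metric.eventually_nhds_iff_ball.1
    (ENNReal.tendsto_nhds_zero.1 (tendsto_eLpNorm_translate f) ε hε)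
  filter_upwards [hb.eventually_lt_const hδ] with n hn
  simp only [mollify_sub_apply]
  refine eLpNorm_integral_translate_le (Lp.stronglyMeasurable f) _ ?_
  filter_upwards [ae_bumpMeasure_mem_ball (b n)] with t ht
  exact hball t (Metric.ball_subset_ball hn.le ht)

theorem mollify_eq_zero (b : ContDiffBump (0 : Plane)) {f : L2} {K : Set Plane}
    (hf : ∀ᵐ x : Plane, x ∉ K → f x = 0) {x : Plane} (hx : x ∉ Metric.cthickening b.rOut K) :
    mollify b f x = 0 := by
  rw [mollify_apply']
  refine integral_eq_zero_of_ae ?_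
  filter_upwards [hf] with t ht
  by_cases htK : t ∈ K
  · have : x - t ∉ Function.support (b.normed (volume : Measure Plane)) := by
      rw [b.support_normed_eq, mem_ball_zero_iff, ← dist_eq_norm]
      exact fun h => hx (Metric.mem_cthickening_of_dist_le x t _ _ htK h.le)
    rw [Function.notMem_support.1 this]
    simp
  · rw [ht htK]
    simp

/-- `g` is the weak derivative `∂_j f` on the whole plane. -/
def IsWeakDeriv (j : Fin 2) (f g : L2) : Prop :=
  ∀ φ : 𝓓((⊤ : TopologicalSpace.Opens Plane), ℂ),
    ∫ x, partialDeriv j φ x * f x = -∫ x, φ x * g x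

/-- Mollification commutes with weak derivatives. -/
theorem partialDeriv_mollify (b : ContDiffBump (0 : Plane)) {j : Fin 2} {f g : L2}
    (h : IsWeakDeriv j f g) : partialDeriv j (mollify b f) = mollify b g := by
  funext x
  have hd := (b.hasCompactSupport_normed (μ := volume)).hasFDerivAt_convolution_left (μ := volume)
    (ContinuousLinearMap.lsmul ℝ ℝ) (b.contDiff_normed (n := 1)) (locallyIntegrable_L2 f) x
  have hb : Differentiable ℝ (b.normed (volume : Measure Plane)) :=
    (b.contDiff_normed (n := 1)).differentiable (by simp)
  -- Test the weak derivative against the reflected kernel `t ↦ ρ(x - t)`; the sign from the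
  -- reflection cancels the one from integration by parts.
  let φ : 𝓓((⊤ : TopologicalSpace.Opens Plane), ℂ) :=
    { toFun := fun t => (b.normed volume (x - t) : ℂ)
      contDiff' := Complex.ofRealCLM.contDiff.comp
        (b.contDiff_normed.comp (contDiff_const.sub contDiff_id))
      hasCompactSupport' := ((b.hasCompactSupport_normed (μ := volume)).comp_homeomorph
        (Homeomorph.subLeft x)).comp_left (g := ((↑) : ℝ → ℂ)) (by simp)
      tsupport_subset' := fun _ _ => trivial }
  have hφ : ∀ t, φ t = (b.normed volume (x - t) : ℂ) := fun _ => rfl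
  have hφ' : ∀ t, partialDeriv j φ t =
      -((fderiv ℝ (b.normed volume) (x - t) (EuclideanSpace.single j 1) : ℝ) : ℂ) := by
    intro t
    have h1 : HasFDerivAt (fun t : Plane => x - t) (-ContinuousLinearMap.id ℝ Plane) t :=
      (hasFDerivAt_id t).const_sub x
    have h2 := Complex.ofRealCLM.hasFDerivAt.comp t ((hb (x - t)).hasFDerivAt.comp t h1)
    have h3 : (φ : Plane → ℂ) = Complex.ofRealCLM ∘ (b.normed volume ∘ fun t => x - t) := rfl
    rw [partialDeriv, h3, h2.fderiv]
    simp
  have hint := ((b.hasCompactSupport_normed (μ := volume)).fderiv ℝ).convolutionExists_left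
    ((ContinuousLinearMap.lsmul ℝ ℝ : ℝ →L[ℝ] ℂ →L[ℝ] ℂ).precompL Plane)
    ((b.contDiff_normed (n := 1)).continuous_fderiv (by simp)) (locallyIntegrable_L2 f) x
  rw [partialDeriv, mollify, hd.fderiv, convolution_eq_swap, mollify_apply']
  refine (ContinuousLinearMap.integral_apply hint.integrable_swap _).trans ?_
  have key := h φ
  simp only [hφ, hφ'] at key
  simp only [ContinuousLinearMap.precompL_apply, ContinuousLinearMap.lsmul_apply, Complex.real_smul]
  rw [← neg_eq_iff_eq_neg, ← integral_neg] at key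
  rw [← key]
  congr 1 with t
  ring


/-! ### Approximation by test functions -/

/-- Used with `w` the error of the magnetic gradient, `u` that of the weak derivative, `v` that of
the function, and `M` a bound on the potential. -/
theorem tendsto_eLpNorm_of_norm_le {X : Type*} [MeasurableSpace X] {μ : Measure X}
    {u v w : ℕ → X → ℂ} (M : ℝ) (hum : ∀ n, AEStronglyMeasurable (u n) μ)
    (hvm : ∀ n, AEStronglyMeasurable (v n) μ)
    (hu : Tendsto (fun n => eLpNorm (u n) 2 μ) atTop (𝓝 0))
    (hv : Tendsto (fun n => eLpNorm (v n) 2 μ) atTop (𝓝 0))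
    (h : ∀ᶠ n in atTop, ∀ᵐ x ∂μ, ‖w n x‖ ≤ ‖u n x‖ + M * ‖v n x‖) :
    Tendsto (fun n => eLpNorm (w n) 2 μ) atTop (𝓝 0) := by
  have hlim : Tendsto (fun n => eLpNorm (u n) 2 μ + ENNReal.ofReal |M| * eLpNorm (v n) 2 μ) atTop
      (𝓝 0) := by
    simpa using hu.add (ENNReal.Tendsto.const_mul hv (Or.inr ENNReal.ofReal_ne_top))
  refine tendsto_of_tendsto_of_tendsto_of_le_of_le' tendsto_const_nhds hlim
    (Eventually.of_forall fun _ => zero_le) ?_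
  filter_upwards [h] with n hn
  calc eLpNorm (w n) 2 μ ≤ eLpNorm (fun x => ‖u n x‖ + |M| * ‖v n x‖) 2 μ := by
        refine eLpNorm_mono_ae_real ?_
        filter_upwards [hn] with x hx
        refine hx.trans ?_
        gcongr
        exact le_abs_self M
    _ ≤ eLpNorm (fun x => ‖u n x‖) 2 μ + eLpNorm (fun x => |M| * ‖v n x‖) 2 μ :=
        eLpNorm_add_le (hum n).norm ((hvm n).norm.const_mul _) one_le_two
    _ ≤ _ := by
        rw [eLpNorm_norm]
        gcongr
        refine eLpNorm_le_mul_eLpNorm_of_ae_le_mul (Eventually.of_forall fun x => ?_) 2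
        simp

theorem tendsto_eLpNorm_of_dominated {X : Type*} [MeasurableSpace X] {μ : Measure X}
    {u : ℕ → X → ℂ} {G : X → ℝ} (hG : MemLp G 2 μ) (hum : ∀ n, AEStronglyMeasurable (u n) μ)
    (hb : ∀ n, ∀ᵐ x ∂μ, ‖u n x‖ ≤ G x) (hlim : ∀ᵐ x ∂μ, Tendsto (fun n => u n x) atTop (𝓝 0)) :
    Tendsto (fun n => eLpNorm (u n) 2 μ) atTop (𝓝 0) := by
  have h : Tendsto (fun n => eLpNorm (u n) 2 μ ^ 2) atTop (𝓝 0) := by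
    simp only [eLpNorm_two_sq]
    have := tendsto_lintegral_of_dominated_convergence' (μ := μ)
      (F := fun n x => ‖u n x‖ₑ ^ 2) (f := fun _ => 0) (fun x => ‖G x‖ₑ ^ 2)
      (fun n => (hum n).enorm.pow_const 2) (fun n => ?_) ?_ ?_
    · simpa using this
    · filter_upwards [hb n] with x hx
      refine pow_le_pow_left' ?_ 2
      exact enorm_le_iff_norm_le.2 (hx.trans (le_abs_self _))
    · rw [← eLpNorm_two_sq]
      exact ENNReal.pow_ne_top hG.eLpNorm_ne_top
    · filter_upwards [hlim] with x hx
      have := (ENNReal.continuous_pow 2).tendsto _ |>.comp (hx.enorm)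
      simpa [Function.comp_def] using this
  rw [ENNReal.tendsto_nhds_zero] at h ⊢
  intro ε hε
  filter_upwards [h (ε ^ 2) (ENNReal.pow_pos hε 2)] with n hn
  exact (ENNReal.pow_le_pow_left_iff two_ne_zero).1 hn

/-- A compactly supported function in the Sobolev space of the punctured plane is in the form
domain. -/
theorem mem_magGraph_of_isCompact {α : ℝ} {f : L2} {K : Set Plane} (hK : IsCompact K)
    (hKp : K ⊆ (punctured : Set Plane)) (hf : ∀ᵐ x : Plane, x ∉ K → f x = 0) {h : Fin 2 → L2}
    (hw : ∀ j, IsWeakDeriv j f (h j)) {k : PiLp 2 fun _ : Fin 2 => L2}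
    (hk : ∀ j, k j =ᵐ[volume] fun x => -Complex.I * h j x + (potential α x j : ℂ) * f x) :
    WithLp.toLp 2 (f, k) ∈ magGraph α := by
  -- Radii of at most `δ` keep all mollifications inside one compact thickening of `K` that avoids
  -- the origin; there the potential is bounded.
  obtain ⟨δ, hδ, hδK⟩ := hK.exists_cthickening_subset_open punctured.isOpen hKp
  have hKc : IsCompact (Metric.cthickening δ K) := hK.cthickening
  let b : ℕ → ContDiffBump (0 : Plane) := fun n =>
    { rIn := δ / (n + 1) / 2
      rOut := δ / (n + 1)
      rIn_pos := by positivity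
      rIn_lt_rOut := half_lt_self (by positivity) }
  have hb : Tendsto (fun n => (b n).rOut) atTop (𝓝 0) := by
    change Tendsto (fun n : ℕ => δ / ((n : ℝ) + 1)) atTop (𝓝 0)
    exact tendsto_const_nhds.div_atTop (tendsto_natCast_atTop_atTop.atTop_add tendsto_const_nhds)
  have hbδ : ∀ n, (b n).rOut ≤ δ := fun n => by
    change δ / ((n : ℝ) + 1) ≤ δ
    exact div_le_self hδ.le (by linarith [(Nat.cast_nonneg n : (0 : ℝ) ≤ n)])
  have hzero : ∀ n, ∀ x ∉ Metric.cthickening δ K, mollify (b n) f x = 0 := fun n x hx =>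
    mollify_eq_zero (b n) hf fun hx' => hx (Metric.cthickening_mono (hbδ n) K hx')
  have hsupp : ∀ n, tsupport (mollify (b n) f) ⊆ Metric.cthickening δ K := fun n =>
    closure_minimal (fun x hx => by_contra fun hx' => hx (hzero n x hx')) Metric.isClosed_cthickening
  let φ : ℕ → 𝓓(punctured, ℂ) := fun n =>
    { toFun := mollify (b n) f
      contDiff' := contDiff_mollify (b n) f
      hasCompactSupport' := hKc.of_isClosed_subset (isClosed_tsupport _) (hsupp n)
      tsupport_subset' := (hsupp n).trans hδK }
  have hmeas : ∀ (g : L2) n, AEStronglyMeasurable (fun x => mollify (b n) g x - g x) volume :=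
    fun g n => ((contDiff_mollify (b n) g).continuous.aestronglyMeasurable).sub
      (Lp.aestronglyMeasurable g)
  refine mem_magGraph_iff.2 ⟨φ, ?_, fun j => ?_⟩
  · exact tendsto_eLpNorm_testL2_iff.1 (tendsto_eLpNorm_mollify hb f)
  · obtain ⟨M, hM⟩ := hKc.exists_bound_of_continuousOn (f := fun x => (potential α x j : ℂ))
      fun x hx => (Complex.continuous_ofReal.continuousAt.comp
        (contDiffAt_potential α j (mem_punctured.1 (hδK hx)) (n := 0)).continuousAt).continuousWithinAt
    rw [← tendsto_eLpNorm_testL2_iff]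
    refine tendsto_eLpNorm_of_norm_le M (hmeas (h j)) (hmeas f)
      (tendsto_eLpNorm_mollify hb (h j)) (tendsto_eLpNorm_mollify hb f)
      (Eventually.of_forall fun n => ?_)
    filter_upwards [hk j, hf] with x hx hfx
    have e : magTest α j (φ n) x - k j x = -Complex.I * (mollify (b n) (h j) x - h j x) +
        (potential α x j : ℂ) * (mollify (b n) f x - f x) := by
      rw [hx, ← partialDeriv_mollify (b n) (hw j)]
      change -Complex.I * partialDeriv j (mollify (b n) f) x +
        (potential α x j : ℂ) * mollify (b n) f x - _ = _
      ring
    rw [e]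
    refine (norm_add_le _ _).trans ?_
    rw [norm_mul, norm_mul, norm_neg, Complex.norm_I, one_mul]
    refine add_le_add le_rfl ?_
    by_cases hxK : x ∈ Metric.cthickening δ K
    · gcongr
      exact hM x hxK
    · rw [hzero n x hxK, hfx fun hx' => hxK (Metric.self_subset_cthickening K hx')]
      simp

theorem memLp_mul_of_continuous {a : Plane → ℂ} (ha : Continuous a) (hc : HasCompactSupport a)
    (f : L2) : MemLp (fun x => a x * f x) 2 volume := by
  obtain ⟨C, hC⟩ := ha.bounded_above_of_compact_support hc
  refine (Lp.memLp f).of_le_mul (c := C)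
    (ha.aestronglyMeasurable.mul (Lp.aestronglyMeasurable f)) (Eventually.of_forall fun x => ?_)
  rw [norm_mul]
  gcongr
  exact hC x

theorem integrable_mul_L2 {a : Plane → ℂ} (ha : Continuous a) (hc : HasCompactSupport a)
    (f : L2) : Integrable fun x => a x * f x := by
  have : MemLp a 2 (volume : Measure Plane) := ha.memLp_of_hasCompactSupport hc
  exact this.integrable_mul (Lp.memLp f)

theorem continuous_partialDeriv {Ω : TopologicalSpace.Opens Plane} (η : 𝓓(Ω, ℂ)) (j : Fin 2) :
    Continuous (partialDeriv j η) :=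
  (contDiff_partialDeriv η.contDiff j).continuous

theorem hasCompactSupport_partialDeriv {Ω : TopologicalSpace.Opens Plane} (η : 𝓓(Ω, ℂ))
    (j : Fin 2) : HasCompactSupport (partialDeriv j η) :=
  η.hasCompactSupport.of_isClosed_subset (isClosed_tsupport _) (tsupport_partialDeriv_subset j η)

/-- The product of an `L²` function with a test function. -/
def mulTest (η : 𝓓(punctured, ℂ)) (f : L2) : L2 :=
  (memLp_mul_of_continuous η.continuous η.hasCompactSupport f).toLp _

theorem coeFn_mulTest (η : 𝓓(punctured, ℂ)) (f : L2) :
    mulTest η f =ᵐ[volume] fun x => η x * f x := MemLp.coeFn_toLp _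

/-- The product of an `L²` function with the derivative of a test function. -/
def mulDerivTest (j : Fin 2) (η : 𝓓(punctured, ℂ)) (f : L2) : L2 :=
  (memLp_mul_of_continuous (continuous_partialDeriv η j) (hasCompactSupport_partialDeriv η j)
    f).toLp _

theorem coeFn_mulDerivTest (j : Fin 2) (η : 𝓓(punctured, ℂ)) (f : L2) :
    mulDerivTest j η f =ᵐ[volume] fun x => partialDeriv j η x * f x := MemLp.coeFn_toLp _

/-- Leibniz rule for weak derivatives. -/
theorem IsWeakDeriv.mulTest {j : Fin 2} {f g : L2} (h : IsWeakDeriv j f g) (η : 𝓓(punctured, ℂ)) :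
    IsWeakDeriv j (mulTest η f) (mulTest η g + mulDerivTest j η f) := by
  intro φ
  -- The rule follows by testing the weak derivative of `f` against the product `φ η`.
  let χ : 𝓓((⊤ : TopologicalSpace.Opens Plane), ℂ) :=
    { toFun := fun x => φ x * η x
      contDiff' := φ.contDiff.mul η.contDiff
      hasCompactSupport' := φ.hasCompactSupport.mul_right
      tsupport_subset' := fun _ _ => trivial }
  have hχ : ∀ x, partialDeriv j χ x = φ x * partialDeriv j η x + η x * partialDeriv j φ x :=
    fun x => partialDeriv_mul (φ.differentiableAt x) (η.differentiableAt x) j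
  have hdη := continuous_partialDeriv η j
  have hdφ := continuous_partialDeriv φ j
  have i1 : Integrable fun x => φ x * partialDeriv j η x * f x :=
    integrable_mul_L2 (φ.continuous.mul hdη) φ.hasCompactSupport.mul_right f
  have i2 : Integrable fun x => η x * partialDeriv j φ x * f x :=
    integrable_mul_L2 (η.continuous.mul hdφ) η.hasCompactSupport.mul_right f
  have i3 : Integrable fun x => φ x * η x * g x :=
    integrable_mul_L2 (φ.continuous.mul η.continuous) φ.hasCompactSupport.mul_right g
  have e1 : ∫ x, partialDeriv j φ x * AharonovBohm.mulTest η f x =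
      ∫ x, η x * partialDeriv j φ x * f x := by
    refine integral_congr_ae ?_
    filter_upwards [coeFn_mulTest η f] with x hx
    rw [hx]
    ring
  have e2 : ∫ x, φ x * (AharonovBohm.mulTest η g + mulDerivTest j η f : L2) x =
      (∫ x, φ x * η x * g x) + ∫ x, φ x * partialDeriv j η x * f x := by
    rw [← integral_add i3 i1]
    refine integral_congr_ae ?_
    filter_upwards [coeFn_mulTest η g, coeFn_mulDerivTest j η f,
      Lp.coeFn_add (AharonovBohm.mulTest η g) (mulDerivTest j η f)] with x h1 h2 h3
    rw [h3, Pi.add_apply, h1, h2]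
    ring
  have key := h χ
  simp only [hχ, add_mul] at key
  rw [integral_add i1 i2] at key
  rw [e1, e2]
  change _ = -∫ x, φ x * η x * g x at key
  linear_combination key

/-- Cutoff functions exhausting the punctured plane, with gradient of order `1 / |x|`. -/
theorem exists_cutoff : ∃ (η : ℕ → 𝓓(punctured, ℂ)) (C : ℝ), (∀ n x, ‖η n x‖ ≤ 2) ∧
    (∀ n j x, ‖x‖ * ‖partialDeriv j (η n) x‖ ≤ C) ∧
    ∀ x ≠ 0, ∀ᶠ n in atTop, η n x = 1 ∧ ∀ j, partialDeriv j (η n) x = 0 := by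
  let b : ContDiffBump (0 : Plane) := ⟨1, 2, one_pos, one_lt_two⟩
  let B : Plane → ℂ := fun x => (b x : ℂ)
  have hB : ContDiff ℝ (⊤ : ℕ∞) B := Complex.ofRealCLM.contDiff.comp b.contDiff
  have hBd : Differentiable ℝ B := hB.differentiable (by simp)
  have hBc : HasCompactSupport B := b.hasCompactSupport.comp_left (g := ((↑) : ℝ → ℂ)) (by simp)
  have hBnorm : ∀ x, ‖B x‖ ≤ 1 := fun x => by
    rw [Complex.norm_real, Real.norm_of_nonneg b.nonneg]
    exact b.le_one
  have hB1 : ∀ x : Plane, ‖x‖ ≤ 1 → B x = 1 := fun x hx => by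
    simp only [B]
    rw [b.one_of_mem_closedBall (by simpa using hx)]
    simp
  have hB0 : ∀ x : Plane, 2 ≤ ‖x‖ → B x = 0 := fun x hx => by
    simp only [B]
    rw [b.zero_of_le_dist (by simpa using hx)]
    simp
  have hdB1 : ∀ j, ∀ x : Plane, ‖x‖ < 1 → partialDeriv j B x = 0 := fun j x hx => by
    have : B =ᶠ[𝓝 x] fun _ => 1 := by
      filter_upwards [(isOpen_lt continuous_norm continuous_const).mem_nhds hx] with y hy
      exact hB1 y (le_of_lt hy)
    rw [partialDeriv, this.fderiv_eq]
    simp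
  have hdB0 : ∀ j, ∀ x : Plane, 2 < ‖x‖ → partialDeriv j B x = 0 := fun j x hx => by
    have : B =ᶠ[𝓝 x] fun _ => 0 := by
      filter_upwards [(isOpen_lt continuous_const continuous_norm).mem_nhds hx] with y hy
      exact hB0 y (le_of_lt hy)
    rw [partialDeriv, this.fderiv_eq]
    simp
  -- The quantity `‖x‖ |∂_j B(x)|` is compatible with dilations, so one bound serves every scale.
  have hdBound : ∃ C, ∀ j x, ‖x‖ * ‖partialDeriv j B x‖ ≤ C := by
    have h : ∀ j, ∃ C, ∀ x, ‖x‖ * ‖partialDeriv j B x‖ ≤ C := fun j => by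
      obtain ⟨C, hC⟩ := ((contDiff_partialDeriv hB j).continuous).bounded_above_of_compact_support
        (hBc.of_isClosed_subset (isClosed_tsupport _) (tsupport_partialDeriv_subset j B))
      have hC0 : 0 ≤ C := (norm_nonneg _).trans (hC 0)
      refine ⟨2 * C, fun x => ?_⟩
      rcases le_or_gt ‖x‖ 2 with hx | hx
      · exact mul_le_mul hx (hC x) (norm_nonneg _) zero_le_two
      · rw [hdB0 j x hx]
        simpa using hC0
    choose C hC using h
    exact ⟨max (C 0) (C 1), fun j x => (hC j x).trans (by fin_cases j <;> simp)⟩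
  obtain ⟨C, hC⟩ := hdBound
  have hs : ∀ n : ℕ, (0 : ℝ) < n + 1 := fun n => by positivity
  have hscale : ∀ (c : ℝ) j x, partialDeriv j (fun y => B (c • y)) x = c * partialDeriv j B (c • x) := by
    intro c j x
    have h := (hBd (c • x)).hasFDerivAt.comp x ((hasFDerivAt_id x).const_smul c)
    change fderiv ℝ (B ∘ HSMul.hSMul c) x _ = _
    rw [h.fderiv]
    simp [partialDeriv]
  have hcd : ∀ c : ℝ, ContDiff ℝ (⊤ : ℕ∞) fun y => B (c • y) := fun c =>
    hB.comp (contDiff_const_smul c)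
  have hnorm : ∀ (n : ℕ) (x : Plane), ‖((n : ℝ) + 1) • x‖ = ((n : ℝ) + 1) * ‖x‖ := fun n x => by
    rw [norm_smul, Real.norm_of_nonneg (hs n).le]
  have hnorm' : ∀ (n : ℕ) (x : Plane), ‖((n : ℝ) + 1)⁻¹ • x‖ = ‖x‖ / ((n : ℝ) + 1) := fun n x => by
    rw [norm_smul, Real.norm_of_nonneg (inv_nonneg.2 (hs n).le), inv_mul_eq_div]
  have hone : ∀ n : ℕ, (1 : ℝ) ≤ n + 1 := fun n => by
    linarith [(Nat.cast_nonneg n : (0 : ℝ) ≤ n)]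
  -- The first bump cuts off at infinity; subtracting the second removes a neighbourhood of the
  -- origin.
  let η₀ : ℕ → Plane → ℂ := fun n x => B (((n : ℝ) + 1)⁻¹ • x) - B (((n : ℝ) + 1) • x)
  let A : ℕ → Set Plane := fun n =>
    Metric.closedBall 0 (2 * ((n : ℝ) + 1)) ∩ {x | ((n : ℝ) + 1)⁻¹ ≤ ‖x‖}
  have hAc : ∀ n, IsCompact (A n) := fun n =>
    (isCompact_closedBall _ _).inter_right (isClosed_le continuous_const continuous_norm)
  have hAs : ∀ n, tsupport (η₀ n) ⊆ A n := fun n => by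
    refine closure_minimal (fun x hx => ?_) (hAc n).isClosed
    by_contra hxA
    refine hx ?_
    simp only [η₀]
    -- Near the origin both bumps equal `1`, far away both equal `0`.
    rcases lt_or_ge ‖x‖ ((n : ℝ) + 1)⁻¹ with h | h
    · rw [hB1 _, hB1 _, sub_self]
      · rw [hnorm, mul_comm, ← le_div_iff₀ (hs n), one_div]
        exact h.le
      · rw [hnorm', div_le_one (hs n)]
        exact h.le.trans ((inv_le_one_of_one_le₀ (hone n)).trans (hone n))
    · have h2 : 2 * ((n : ℝ) + 1) < ‖x‖ := by
        by_contra h2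
        exact hxA ⟨by simpa using h2, h⟩
      rw [hB0 _, hB0 _, sub_self]
      · rw [hnorm]
        nlinarith [hone n]
      · rw [hnorm', le_div_iff₀ (hs n)]
        exact h2.le
  have hAp : ∀ n, A n ⊆ (punctured : Set Plane) := fun n x hx => by
    rw [mem_punctured]
    rintro rfl
    have := hx.2
    simp only [Set.mem_ofPred_eq, norm_zero] at this
    exact absurd (inv_pos.2 (hs n)) (not_lt.2 this)
  let η : ℕ → 𝓓(punctured, ℂ) := fun n =>
    { toFun := η₀ n
      contDiff' := (hcd _).sub (hcd _)
      hasCompactSupport' := (hAc n).of_isClosed_subset (isClosed_tsupport _) (hAs n)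
      tsupport_subset' := (hAs n).trans (hAp n) }
  have hη : ∀ n x, η n x = B (((n : ℝ) + 1)⁻¹ • x) - B (((n : ℝ) + 1) • x) := fun _ _ => rfl
  have hη' : ∀ n j x, partialDeriv j (η n) x =
      ((((n : ℝ) + 1)⁻¹ : ℝ) : ℂ) * partialDeriv j B (((n : ℝ) + 1)⁻¹ • x) -
        (((n : ℝ) + 1 : ℝ) : ℂ) * partialDeriv j B (((n : ℝ) + 1) • x) := by
    intro n j x
    have h1 := hscale ((n : ℝ) + 1)⁻¹ j x
    have h2 := hscale ((n : ℝ) + 1) j x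
    have hd : ∀ c : ℝ, DifferentiableAt ℝ (fun y => B (c • y)) x := fun c =>
      (hcd c).differentiable (by simp) x
    have h3 : partialDeriv j (η n) x = partialDeriv j (fun y => B (((n : ℝ) + 1)⁻¹ • y)) x -
        partialDeriv j (fun y => B (((n : ℝ) + 1) • y)) x := by
      change fderiv ℝ (fun y => B (((n : ℝ) + 1)⁻¹ • y) - B (((n : ℝ) + 1) • y)) x _ = _
      rw [fderiv_fun_sub (hd _) (hd _)]
      rfl
    rw [h3, h1, h2]
  have hev : ∀ x : Plane, x ≠ 0 → ∀ᶠ n : ℕ in atTop,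
      ‖((n : ℝ) + 1)⁻¹ • x‖ < 1 ∧ 2 < ‖((n : ℝ) + 1) • x‖ := by
    intro x hx
    have hx' : 0 < ‖x‖ := norm_pos_iff.2 hx
    have ht : Tendsto (fun n : ℕ => (n : ℝ) + 1) atTop atTop :=
      tendsto_natCast_atTop_atTop.atTop_add tendsto_const_nhds
    filter_upwards [ht.eventually_gt_atTop ‖x‖, ht.eventually_gt_atTop (2 / ‖x‖)] with n h1 h2
    rw [hnorm, hnorm']
    exact ⟨(div_lt_one (hs n)).2 h1, (div_lt_iff₀ hx').1 h2⟩
  refine ⟨η, 2 * C, fun n x => ?_, fun n j x => ?_, fun x hx => ?_⟩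
  · rw [hη]
    refine (norm_sub_le _ _).trans ?_
    linarith [hBnorm (((n : ℝ) + 1)⁻¹ • x), hBnorm (((n : ℝ) + 1) • x)]
  · rw [hη']
    have h1 := hC j (((n : ℝ) + 1)⁻¹ • x)
    have h2 := hC j (((n : ℝ) + 1) • x)
    rw [norm_smul] at h1 h2
    have h3 := norm_sub_le (((((n : ℝ) + 1)⁻¹ : ℝ) : ℂ) * partialDeriv j B (((n : ℝ) + 1)⁻¹ • x))
      ((((n : ℝ) + 1 : ℝ) : ℂ) * partialDeriv j B (((n : ℝ) + 1) • x))
    rw [norm_mul, norm_mul, Complex.norm_real, Complex.norm_real] at h3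
    refine (mul_le_mul_of_nonneg_left h3 (norm_nonneg x)).trans ?_
    linarith
  · filter_upwards [hev x hx] with n hn
    refine ⟨?_, fun j => ?_⟩
    · rw [hη, hB1 _ hn.1.le, hB0 _ hn.2.le, sub_zero]
    · rw [hη', hdB1 j _ hn.1, hdB0 j _ hn.2, mul_zero, mul_zero, sub_zero]

/-- Since `|A_α(x)| = α / ‖x‖`, and the Euclidean norm is at most the sum of the absolute
components, integrability of `A_α ψ` controls `ψ / |x|`. -/
theorem inv_norm_le_potential {α : ℝ} (hα : 0 < α) {x : Plane} (hx : x ≠ 0) :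
    ‖x‖⁻¹ ≤ α⁻¹ * (|potential α x 0| + |potential α x 1|) := by
  have hn : 0 < ‖x‖ := norm_pos_iff.2 hx
  have h : (α * ‖x‖⁻¹) ^ 2 = |potential α x 0| ^ 2 + |potential α x 1| ^ 2 := by
    rw [sq_abs, sq_abs, potential_zero, potential_one]
    have h := plane_norm_sq x
    field_simp
    linear_combination h
  have h2 : α * ‖x‖⁻¹ ≤ |potential α x 0| + |potential α x 1| := by
    refine abs_le_of_sq_le_sq' ?_ (by positivity) |>.2
    rw [h]
    nlinarith [mul_nonneg (abs_nonneg (potential α x 0)) (abs_nonneg (potential α x 1))]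
  rw [inv_mul_eq_div, le_div_iff₀ hα, mul_comm]
  exact h2

/-- Cutting off adds the commutator term `(∂_j η_n) ψ`. It is dominated by a multiple of `|ψ| /
|x|`, which is in `L²`, and tends to `0` pointwise, so it disappears in `L²`; closedness of the
graph then admits `ψ`. -/
theorem mem_friedrichsDomain_of_memH1 {α : ℝ} (hα : 0 < α) {ψ : L2} (hψ : MemH1 ψ)
    (hA : ∀ j : Fin 2, MemLp (fun x : Plane => (potential α x j : ℂ) * ψ x) 2 volume) :
    ψ ∈ friedrichsDomain α := by
  obtain ⟨g, hg⟩ := hψ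
  have hw : ∀ j, IsWeakDeriv j ψ (g j) := hg
  obtain ⟨η, C, hη2, hηC, hη⟩ := exists_cutoff
  have hC0 : 0 ≤ C := (mul_nonneg (norm_nonneg _) (norm_nonneg _)).trans (hηC 0 0 0)
  let k : Fin 2 → L2 := fun j => -Complex.I • g j + (hA j).toLp _
  have hk : ∀ j, k j =ᵐ[volume] fun x => -Complex.I * g j x + (potential α x j : ℂ) * ψ x := by
    intro j
    filter_upwards [Lp.coeFn_add (-Complex.I • g j) ((hA j).toLp _),
      Lp.coeFn_smul (-Complex.I) (g j), (hA j).coeFn_toLp] with x h1 h2 h3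
    rw [h1, Pi.add_apply, h2, h3]
    rfl
  -- The magnetic gradient of `η_n ψ`, by the Leibniz rule.
  let kn : ℕ → Fin 2 → L2 := fun n j =>
    mulTest (η n) (k j) - Complex.I • mulDerivTest j (η n) ψ
  have hkn : ∀ n j, kn n j =ᵐ[volume] fun x =>
      η n x * k j x - Complex.I * (partialDeriv j (η n) x * ψ x) := by
    intro n j
    filter_upwards [Lp.coeFn_sub (mulTest (η n) (k j)) (Complex.I • mulDerivTest j (η n) ψ),
      Lp.coeFn_smul Complex.I (mulDerivTest j (η n) ψ), coeFn_mulTest (η n) (k j),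
      coeFn_mulDerivTest j (η n) ψ] with x h1 h2 h3 h4
    rw [h1, Pi.sub_apply, h2, h3, Pi.smul_apply, h4]
    rfl
  have hmem : ∀ n, WithLp.toLp 2 (mulTest (η n) ψ, WithLp.toLp 2 (kn n)) ∈ magGraph α := by
    intro n
    refine mem_magGraph_of_isCompact (η n).hasCompactSupport (η n).tsupport_subset ?_
      (fun j => (hw j).mulTest (η n)) fun j => ?_
    · filter_upwards [coeFn_mulTest (η n) ψ] with x hx hxK
      rw [hx, image_eq_zero_of_notMem_tsupport hxK, zero_mul]
    · filter_upwards [hkn n j, hk j, coeFn_mulTest (η n) ψ, coeFn_mulTest (η n) (g j),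
        coeFn_mulDerivTest j (η n) ψ,
        Lp.coeFn_add (mulTest (η n) (g j)) (mulDerivTest j (η n) ψ)] with x h1 h2 h3 h4 h5 h6
      rw [h1, h2, h3, h6, Pi.add_apply, h4, h5]
      ring
  have hmul : ∀ f : L2, Tendsto (fun n => mulTest (η n) f) atTop (𝓝 f) := by
    intro f
    rw [Lp.tendsto_Lp_iff_tendsto_eLpNorm']
    -- The constant `3` is the bound `2` on the cutoff plus `1` from subtracting `f`.
    refine tendsto_eLpNorm_of_dominated ((Lp.memLp f).norm.const_mul 3)
      (fun n => (Lp.aestronglyMeasurable _).sub (Lp.aestronglyMeasurable _)) (fun n => ?_) ?_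
    · filter_upwards [coeFn_mulTest (η n) f] with x hx
      rw [Pi.sub_apply, hx]
      refine (norm_sub_le _ _).trans ?_
      rw [norm_mul]
      nlinarith [hη2 n x, norm_nonneg (f x)]
    · filter_upwards [ae_all_iff.2 fun n => coeFn_mulTest (η n) f, ae_ne_zero] with x hx h0
      refine tendsto_const_nhds.congr' ?_
      filter_upwards [hη x h0] with n hn
      rw [Pi.sub_apply, hx, hn.1, one_mul, sub_self]
  have hder : ∀ j, Tendsto (fun n => mulDerivTest j (η n) ψ) atTop (𝓝 0) := by
    intro j
    rw [Lp.tendsto_Lp_iff_tendsto_eLpNorm']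
    refine tendsto_eLpNorm_of_dominated
      (((hA 0).norm.add (hA 1).norm).const_mul (C * α⁻¹))
      (fun n => (Lp.aestronglyMeasurable _).sub (Lp.aestronglyMeasurable _)) (fun n => ?_) ?_
    · filter_upwards [coeFn_mulDerivTest j (η n) ψ, ae_ne_zero,
        Lp.coeFn_zero ℂ 2 (volume : Measure Plane)] with x hx h0 hz
      rw [Pi.sub_apply, hx, hz, Pi.zero_apply, sub_zero, norm_mul]
      have h1 : ‖partialDeriv j (η n) x‖ ≤ C * ‖x‖⁻¹ := by
        rw [← div_eq_mul_inv, le_div_iff₀ (norm_pos_iff.2 h0), mul_comm]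
        exact hηC n j x
      calc ‖partialDeriv j (η n) x‖ * ‖ψ x‖
          ≤ C * (α⁻¹ * (|potential α x 0| + |potential α x 1|)) * ‖ψ x‖ := by
            gcongr
            exact h1.trans (mul_le_mul_of_nonneg_left (inv_norm_le_potential hα h0) hC0)
        _ = _ := by
            simp only [Pi.add_apply, norm_mul, Complex.norm_real, Real.norm_eq_abs]
            ring
    · filter_upwards [ae_all_iff.2 fun n => coeFn_mulDerivTest j (η n) ψ, ae_ne_zero,
        Lp.coeFn_zero ℂ 2 (volume : Measure Plane)] with x hx h0 hz
      refine tendsto_const_nhds.congr' ?_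
      filter_upwards [hη x h0] with n hn
      rw [Pi.sub_apply, hx, hn.2 j, zero_mul, hz, Pi.zero_apply, sub_self]
  refine mem_friedrichsDomain_iff.2 ⟨WithLp.toLp 2 k, ?_⟩
  refine (isClosed_magGraph α).mem_of_tendsto (b := atTop) ?_ (Eventually.of_forall hmem)
  refine ((WithLp.prod_continuous_toLp 2 L2 (PiLp 2 fun _ : Fin 2 => L2)).tendsto _).comp
    ((hmul ψ).prodMk_nhds ?_)
  refine ((PiLp.continuous_toLp 2 (fun _ : Fin 2 => L2)).tendsto k).comp
    (tendsto_pi_nhds.2 fun j => ?_)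
  simpa using (hmul (k j)).sub ((hder j).const_smul Complex.I)

end AharonovBohm

end

/-- The Friedrichs realization of the Aharonov-Bohm Hamiltonian with flux `α ∈ (0, 1)`: its form
domain, closedness and nonnegativity of the form, and the associated self-adjoint operator. -/
theorem proposition1 (α : ℝ) (hα₀ : 0 < α) (hα₁ : α < 1) :
    -- the form: its domain, and the form is closed and nonnegative there
    (friedrichsDomain α =
        {ψ : L2 | MemH1 ψ ∧
          ∀ j : Fin 2, MemLp (fun x : Plane => (potential α x j : ℂ) * ψ x) 2 volume} ∧
      (∀ ψ ∈ friedrichsDomain α, IsMagGradient α ψ (magGradient α ψ)) ∧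
      IsClosedNonnegForm (friedrichsDomain α) (friedrichsForm α)) ∧
    -- the operator: the unique self-adjoint operator of the form, its domain and its action
    ∃ T : L2 →ₗ.[ℂ] L2,
      IsSelfAdjoint T ∧
      IsAssociatedOperator (friedrichsDomain α) (friedrichsForm α) T ∧
      (∀ T' : L2 →ₗ.[ℂ] L2, IsSelfAdjoint T' →
        Represents (friedrichsDomain α) (friedrichsForm α) T' → T' = T) ∧
      (T.domain : Set L2) =
        {ψ : L2 | ψ ∈ friedrichsDomain α ∧ ∃ η : L2, IsHamiltonian α ψ η} ∧
      ∀ ψ : T.domain, IsHamiltonian α ψ (T ψ) := by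
  have hG := isGraphOf_magGraph α
  have hcl := isClosed_magGraph α
  have hD := dense_friedrichsDomain α
  have hq := friedrichsForm_eq α
  have hassoc := hG.isAssociatedOperator hD hq
  refine ⟨⟨?_, fun ψ => isMagGradient_magGradient, hG.isClosedNonnegForm hcl hD hq⟩,
    hG.operator, hG.isSelfAdjoint_operator hcl hD, hassoc,
    fun T' hT' hr => hG.eq_operator_of_represents hcl hD hq hT' hr, ?_, fun ψ => ?_⟩
  · exact Set.Subset.antisymm (fun ψ h => memH1_and_memLp_of_mem_friedrichsDomain hα₀ hα₁ h)
      fun ψ h => mem_friedrichsDomain_of_memH1 hα₀ h.1 h.2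
  · ext ψ
    constructor
    · intro h
      have := (hassoc _ _).1 (hG.operator.mem_graph ⟨ψ, h⟩)
      exact ⟨this.1, _, (isHamiltonian_iff_friedrichsForm this.1).2 this.2⟩
    · rintro ⟨h, η, hη⟩
      exact LinearPMap.mem_domain_of_mem_graph
        ((hassoc ψ η).2 ⟨h, (isHamiltonian_iff_friedrichsForm h).1 hη⟩)
  · have := (hassoc _ _).1 (hG.operator.mem_graph ψ)
    exact (isHamiltonian_iff_friedrichsForm this.1).2 this.2
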